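/- **Setting.** Let $u=u_{x,y}$ be a $p\times p$ matrix of compactly supported complex distributions in the variables $(x,y)\in\mathbb C^2$ (smoothness in the real sense; distributions on $\mathbb R^2$ are included). Let $\operatorname{supp}u$ be the union of the supports of the entries, $\operatorname{supp}_xu,\operatorname{supp}_yu\subset\mathbb C$ its two projections, $r_x(u)=\sup\{|z|:z\in\operatorname{supp}_xu\}$ and $r_y(u)=\sup\{|z|:z\in\operatorname{supp}_yu\}$. The sesquilinear form is $(\langle P(x),Q(y)\rangle_u)_{ij}=\sum_{a,b}\langle u_{ab},P_{ia}(x)Q_{jb}(y)\rangle$, for matrix functions that are smooth near the support. For times $t=(t_1,t_2)$, $t_i=(t_{i,1},t_{i,2},\dots)$, put $t_i(x)=\sum_{j\ge1}t_{i,j}x^j$ and $u^t=e^{t_1(x)-t_2(y)}u$, with Gram matrix $G^t$, $G^t_{kl}=\langle I_px^k,I_py^l\rangle_{u^t}$. $G^t$ is quasidefinite if all truncations $(G^t_{ab})_{a,b<k}$ have nonzero determinant; then $G^t=(S_1^t)^{-1}H^t(S_2^t)^{-\top}$ uniquely, with $S_i^t$ block lower unitriangular and $H^t=\operatorname{diag}(H^t_0,H^t_1,\dots)$.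 Define $$P^{[i],t}_n(z)=\sum_{j=0}^n(S^t_i)_{n,j}z^j,\qquad C_n^{[1],t}(z)=\Big\langle P_n^{[1],t}(x),\tfrac{I_p}{z-y}\Big\rangle_{u^t},\qquad \big(C_n^{[2],t}(z)\big)^\top=\Big\langle\tfrac{I_p}{z-x},P_n^{[2],t}(y)\Big\rangle_{u^t},$$ the Baker functions $$\Psi_{1,n}(t,z)=e^{t_1(z)}P_n^{[1],t}(z),\qquad \Psi_{2,n}(t,z)=\Big\langle e^{t_1(x)}P^{[1],t}_n(x),\tfrac{I_p}{z-y}\Big\rangle_u,$$ $$\big(\Psi_{1,n}^*(t,z)\big)^\top=\Big\langle\tfrac{I_p}{z-x},e^{-t_2(y)}P_n^{[2],t}(y)\Big\rangle_u(H_n^t)^{-1},\qquad \Psi^*_{2,n}(t,z)=e^{-t_2(z)}(H^t_n)^{-\top}P_n^{[2],t}(z),$$ and the $\tau$-ratio matrices (with $\tau^{(i)}_{-1}=I_p$) $$\tau_n^{(1)}(t,s)=\big(H^t_n(H^s_n)^{-1}\big)\cdots\big(H^t_0(H^s_0)^{-1}\big),\qquad \tau_n^{(2)}(t,s)=\big((H^t_n)^{-1}H^s_n\big)\cdots\big((H^t_0)^{-1}H^s_0\big).$$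 The Miwa shift is $[z]=(\frac1z,\frac1{2z^2},\frac1{3z^3},\dots)$; $t\pm[z]_i$ means that $[z]$ is added to or subtracted from $t_i$, the series being summed near the support, inside the sesquilinear form. **Theorem (Geronimus–Uvarov bilinear identities).** Let $W_C,W_G\in\mathbb C^{p\times p}[x]$ be matrix polynomials with $W_C$ monic. Let $u$ and $\hat u$ be as above, with $\{z:\det W_G(z)=0\}\cap\operatorname{supp}_yu=\varnothing$ and $\hat u_{x,y}W_G(y)=W_C(x)u_{x,y}$. Hats denote the objects built from $\hat u$. Let $t,t'$ have finitely many nonzero times, and assume that the Gram matrices of $u^t$ and $\hat u^{t'}$ are quasidefinite. Let $r_1>r_x(u)$, $r_2>r_y(\hat u)$ and $k,l\ge0$. Then all integrals below exist (circles positively oriented) and $$\oint_{|z|=r_1}\hat\Psi_{1,k}(t',z)W_C(z)\big(\Psi^*_{1,l}(t,z)\big)^\top dz=\oint_{|z|=r_2}\hat\Psi_{2,k}(t',z)W_G(z)\big(\Psi^*_{2,l}(t,z)\big)^\top dz,$$ $$\oint_{|z|=r_1}e^{t_1'(z)-t_1(z)}\hat P_k^{[1],t'}(z)W_C(z)\big(C_l^{[2],t}(z)\big)^\top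 dz=\oint_{|z|=r_2}\hat C_k^{[1],t'}(z)W_G(z)\big(P_l^{[2],t}(z)\big)^\top e^{t_2'(z)-t_2(z)}dz.$$ If moreover $r_1>r_x(\hat u)$, $r_2>r_y(u)$, and the Gram matrices of $\hat u^{t'-[z]_1}$, $u^{t+[z]_1}$ for all $|z|=r_1$ and of $\hat u^{t'-[z]_2}$, $u^{t+[z]_2}$ for all $|z|=r_2$ are quasidefinite (so that the $\tau$-ratio matrices below are defined), then $$\Big(\oint_{|z|=r_1}e^{t_1'(z)-t_1(z)}z^{k-l-1}\,\hat\tau^{(1)}_{k-1}(t'-[z]_1,t')\,W_C(z)\,\big(\tau_l^{(1)}(t,t+[z]_1)\big)^{-1}dz\Big)H_l^t$$ $$=\hat H_k^{t'}\Big(\oint_{|z|=r_2}z^{l-k-1}\,\hat\tau^{(2)}_k(t',t'-[z]_2)\,W_G(z)\,\big(\tau^{(2)}_{l-1}(t+[z]_2,t)\big)^{-1}e^{t_2'(z)-t_2(z)}dz\Big).$$ -/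

import Mathlib

open scoped Topology ContDiff Polynomial

namespace GUBilinear

noncomputable section

/-- `p × p` complex matrices. -/
abbrev Mat (p : ℕ) : Type := Matrix (Fin p) (Fin p) ℂ

/-! ### Matrices of generalized kernels -/

/-- Complex smooth compactly supported test functions in the two variables `(x, y) ∈ ℂ × ℂ`
(smooth in the real sense). -/
abbrev Test : Type := TestFunction (⊤ : TopologicalSpace.Opens (ℂ × ℂ)) ℂ ⊤

/-- Scalar generalized kernels: complex distributions in the variables `(x, y) ∈ ℂ × ℂ`.
Kernels living on `ℝ × ℝ` are included through restriction of test functions. -/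
abbrev Kernel : Type := Test →L[ℂ] ℂ

/-- A `p × p` matrix `u_{x,y}` of generalized kernels. -/
abbrev MatrixKernel (p : ℕ) : Type := Fin p → Fin p → Kernel

/-- The support of a matrix of kernels: the union of the supports of its entries. -/
def supp {p : ℕ} (u : MatrixKernel p) : Set (ℂ × ℂ) :=
  ⋃ i, ⋃ j, Distribution.dsupport (u i j)

/-- Projected support in the first variable. -/
def suppX {p : ℕ} (u : MatrixKernel p) : Set ℂ := Prod.fst '' supp u

/-- Projected support in the second variable. -/
def suppY {p : ℕ} (u : MatrixKernel p) : Set ℂ := Prod.snd '' supp u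

/-- `r_x = sup {|z| : z ∈ supp_x u}`. -/
def radiusX {p : ℕ} (u : MatrixKernel p) : ℝ := sSup (norm '' suppX u)

/-- `r_y = sup {|z| : z ∈ supp_y u}`. -/
def radiusY {p : ℕ} (u : MatrixKernel p) : ℝ := sSup (norm '' suppY u)

open Classical in
/-- The pairing `⟨T, f⟩` of a compactly supported distribution `T` with a function `f` that is
smooth in a neighbourhood of the support of `T`: the value of `T` at any test function which
agrees with `f` near the support of `T`. -/
def pair (T : Kernel) (f : ℂ × ℂ → ℂ) : ℂ :=
  if h : ∃ φ : Test, (φ : ℂ × ℂ → ℂ) =ᶠ[𝓝ˢ (Distribution.dsupport T)] f then T h.choose else 0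

/-- The sesquilinear form of `u`, on matrix functions `P(x)`, `Q(y)`:
`(⟨P, Q⟩_u)_{ij} = ∑_{a,b} ⟨u_{ab}, P_{ia}(x) Q_{jb}(y)⟩`. -/
def sesq {p : ℕ} (u : MatrixKernel p) (P Q : ℂ → Mat p) : Mat p :=
  Matrix.of fun i j => ∑ a, ∑ b, pair (u a b) (fun q => P q.1 i a * Q q.2 j b)

/-! ### Matrix polynomials and Geronimus–Uvarov transformations -/

/-- The entry `W_{ij}(x)` of a matrix polynomial, as a scalar polynomial. -/
def entry {p : ℕ} (W : (Mat p)[X]) (i j : Fin p) : ℂ[X] := matPolyEquiv.symm W i j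

/-- The value `W(z)` of a matrix polynomial at a complex number. -/
def mval {p : ℕ} (W : (Mat p)[X]) (z : ℂ) : Mat p := Matrix.of fun i j => (entry W i j).eval z

/-- The spectrum `σ(W) = {z : det W(z) = 0}` of a matrix polynomial. -/
def spec {p : ℕ} (W : (Mat p)[X]) : Set ℂ := {z | (mval W z).det = 0}

theorem contDiff_evalX (f : ℂ[X]) : ContDiff ℝ ∞ (fun q : ℂ × ℂ => f.eval q.1) :=
  ((f.contDiff_aeval (𝕜 := ℂ) (n := ∞)).restrict_scalars ℝ).comp contDiff_fst

theorem contDiff_evalY (f : ℂ[X]) : ContDiff ℝ ∞ (fun q : ℂ × ℂ => f.eval q.2) :=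
  ((f.contDiff_aeval (𝕜 := ℂ) (n := ∞)).restrict_scalars ℝ).comp contDiff_snd

/-- The test function `g φ`, for a smooth function `g` and a test function `φ`. -/
def mulTest (g : ℂ × ℂ → ℂ) (hg : ContDiff ℝ ∞ g) (φ : Test) : Test where
  toFun := fun q => g q * φ q
  contDiff' := hg.mul φ.contDiff
  hasCompactSupport' := φ.hasCompactSupport.mul_left
  tsupport_subset' := fun _ _ => trivial

/-- The test function `f(x) φ(x, y)`. -/
def mulX (f : ℂ[X]) (φ : Test) : Test := mulTest _ (contDiff_evalX f) φ

/-- The test function `f(y) φ(x, y)`. -/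
def mulY (f : ℂ[X]) (φ : Test) : Test := mulTest _ (contDiff_evalY f) φ

/-- `v` is a Geronimus–Uvarov transformation of `u`: `σ(W_G) ∩ supp_y u = ∅` and
`v_{x,y} W_G(y) = W_C(x) u_{x,y}`, an equality of matrices of distributions. -/
structure IsGeronimusUvarov {p : ℕ} (WC WG : (Mat p)[X]) (u v : MatrixKernel p) : Prop where
  disjoint : Disjoint (spec WG) (suppY u)
  mul_eq : ∀ (i j : Fin p) (φ : Test),
    ∑ a, v i a (mulY (entry WG a j) φ) = ∑ a, u a j (mulX (entry WC i a) φ)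

/-! ### Times, deformed Gram matrices and their Gauss–Borel factorization -/

/-- A pair `t = (t₁, t₂)` of sequences of times; the time `t_{i,j}`, `j ≥ 1`, is stored at the
index `j - 1`. -/
abbrev Times : Type := (ℕ → ℂ) × (ℕ → ℂ)

/-- `s(x) = ∑_{j ≥ 1} s_j x^j`. -/
def timeSeries (s : ℕ → ℂ) (x : ℂ) : ℂ := ∑' j : ℕ, s j * x ^ (j + 1)

/-- The Miwa shift `[z] = (1/z, 1/(2z²), 1/(3z³), …)`. -/
def miwa (z : ℂ) : ℕ → ℂ := fun j => 1 / (((j : ℂ) + 1) * z ^ (j + 1))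

/-- `[z]₁`: the Miwa shift in the first family of times. -/
def miwa₁ (z : ℂ) : Times := (miwa z, 0)

/-- `[z]₂`: the Miwa shift in the second family of times. -/
def miwa₂ (z : ℂ) : Times := (0, miwa z)

/-- The factor `e^{t₁(x)}`. -/
def expX (t : Times) (x : ℂ) : ℂ := Complex.exp (timeSeries t.1 x)

/-- The factor `e^{-t₂(y)}`. -/
def expY (t : Times) (y : ℂ) : ℂ := Complex.exp (-timeSeries t.2 y)

/-- The sesquilinear form of the deformed kernel `u^t = e^{t₁(x) - t₂(y)} u`. -/
def sesqT {p : ℕ} (u : MatrixKernel p) (t : Times) (P Q : ℂ → Mat p) : Mat p :=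
  sesq u (fun x => expX t x • P x) (fun y => expY t y • Q y)

/-- The Gram matrix `G^t`, with blocks `G^t_{kl} = ⟨I x^k, I y^l⟩_{u^t}`. -/
def gram {p : ℕ} (u : MatrixKernel p) (t : Times) (k l : ℕ) : Mat p :=
  sesqT u t (fun x => x ^ k • (1 : Mat p)) (fun y => y ^ l • (1 : Mat p))

/-- All truncations `G_{[k]} = (G_{ab})_{a,b < k}` have nonzero determinant. -/
def Quasidefinite {p : ℕ} (G : ℕ → ℕ → Mat p) : Prop :=
  ∀ k : ℕ, (Matrix.of fun a b : Fin k × Fin p => G a.1 b.1 a.2 b.2).det ≠ 0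

/-- Block lower unitriangular semi-infinite matrices. -/
def LowerUnitriangular {p : ℕ} (S : ℕ → ℕ → Mat p) : Prop :=
  (∀ n, S n n = 1) ∧ ∀ n m, n < m → S n m = 0

/-- Candidates for the factors of a Gauss–Borel factorization. -/
structure Factors (p : ℕ) where
  S₁ : ℕ → ℕ → Mat p
  S₂ : ℕ → ℕ → Mat p
  H : ℕ → Mat p

/-- The Gauss–Borel factorization `G = S₁⁻¹ H S₂⁻ᵀ` with `S₁, S₂` block lower unitriangular and
`H = diag(H₀, H₁, …)`, written as `S₁ G S₂ᵀ = H` (all sums are finite). -/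
structure IsGaussBorel {p : ℕ} (G : ℕ → ℕ → Mat p) (F : Factors p) : Prop where
  lower₁ : LowerUnitriangular F.S₁
  lower₂ : LowerUnitriangular F.S₂
  eq : ∀ k l : ℕ,
    ∑ i ∈ Finset.range (k + 1), ∑ j ∈ Finset.range (l + 1),
      F.S₁ k i * G i j * (F.S₂ l j).transpose = if k = l then F.H k else 0

open Classical in
/-- The Gauss–Borel factors of `G`; for a quasidefinite `G` they exist and are unique. -/
def gaussBorel {p : ℕ} (G : ℕ → ℕ → Mat p) : Factors p :=
  if h : ∃ F, IsGaussBorel G F then h.choose else ⟨0, 0, 0⟩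

/-- The quasitau matrices `H_n^t`. -/
def quasitau {p : ℕ} (u : MatrixKernel p) (t : Times) (n : ℕ) : Mat p :=
  (gaussBorel (gram u t)).H n

/-! ### Biorthogonal polynomials, second kind functions, Baker functions, `τ`-ratios -/

/-- `P_n^{[1],t}(x)`, the `n`-th entry of `S₁^t χ(x)`. -/
def P₁ {p : ℕ} (u : MatrixKernel p) (t : Times) (n : ℕ) (x : ℂ) : Mat p :=
  ∑ j ∈ Finset.range (n + 1), x ^ j • (gaussBorel (gram u t)).S₁ n j

/-- `P_n^{[2],t}(y)`, the `n`-th entry of `S₂^t χ(y)`. -/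
def P₂ {p : ℕ} (u : MatrixKernel p) (t : Times) (n : ℕ) (y : ℂ) : Mat p :=
  ∑ j ∈ Finset.range (n + 1), y ^ j • (gaussBorel (gram u t)).S₂ n j

/-- The second kind function `C_n^{[1],t}(z) = ⟨P_n^{[1],t}(x), I/(z - y)⟩_{u^t}`. -/
def C₁ {p : ℕ} (u : MatrixKernel p) (t : Times) (n : ℕ) (z : ℂ) : Mat p :=
  sesqT u t (P₁ u t n) (fun y => (z - y)⁻¹ • (1 : Mat p))

/-- The second kind function `C_n^{[2],t}(z)`, with
`(C_n^{[2],t}(z))ᵀ = ⟨I/(z - x), P_n^{[2],t}(y)⟩_{u^t}`. -/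
def C₂ {p : ℕ} (u : MatrixKernel p) (t : Times) (n : ℕ) (z : ℂ) : Mat p :=
  (sesqT u t (fun x => (z - x)⁻¹ • (1 : Mat p)) (P₂ u t n)).transpose

/-- Baker function `Ψ_{1,n}(t,z) = e^{t₁(z)} P_n^{[1],t}(z)`. -/
def Ψ₁ {p : ℕ} (u : MatrixKernel p) (t : Times) (n : ℕ) (z : ℂ) : Mat p :=
  expX t z • P₁ u t n z

/-- Adjoint Baker function `Ψ*_{2,n}(t,z) = e^{-t₂(z)} (H_n^t)⁻ᵀ P_n^{[2],t}(z)`. -/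
def Ψ₂star {p : ℕ} (u : MatrixKernel p) (t : Times) (n : ℕ) (z : ℂ) : Mat p :=
  expY t z • ((quasitau u t n)⁻¹.transpose * P₂ u t n z)

/-- Adjoint Baker function `Ψ*_{1,n}(t,z)`, with
`(Ψ*_{1,n}(t,z))ᵀ = ⟨I/(z - x), e^{-t₂(y)} P_n^{[2],t}(y)⟩_u (H_n^t)⁻¹`
(the original kernel `u`, not `u^t`). -/
def Ψ₁star {p : ℕ} (u : MatrixKernel p) (t : Times) (n : ℕ) (z : ℂ) : Mat p :=
  (sesq u (fun x => (z - x)⁻¹ • (1 : Mat p)) (fun y => expY t y • P₂ u t n y)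
    * (quasitau u t n)⁻¹).transpose

/-- Baker function `Ψ_{2,n}(t,z) = ⟨e^{t₁(x)} P_n^{[1],t}(x), I/(z - y)⟩_u`
(the original kernel `u`, not `u^t`). -/
def Ψ₂ {p : ℕ} (u : MatrixKernel p) (t : Times) (n : ℕ) (z : ℂ) : Mat p :=
  sesq u (fun x => expX t x • P₁ u t n x) (fun y => (z - y)⁻¹ • (1 : Mat p))

/-- The ordered product `A_{N-1} A_{N-2} ⋯ A_0` (equal to `I` for `N = 0`). -/
def descProd {p : ℕ} (A : ℕ → Mat p) : ℕ → Mat p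
  | 0 => 1
  | N + 1 => A N * descProd A N

/-- The `τ`-ratio matrix with `N` factors, i.e. `τ^{(1)}_{N-1}(t,s)`:
the descending product of `H_m^t (H_m^s)⁻¹` over `0 ≤ m ≤ N - 1`. -/
def tau₁ {p : ℕ} (u : MatrixKernel p) (N : ℕ) (t s : Times) : Mat p :=
  descProd (fun m => quasitau u t m * (quasitau u s m)⁻¹) N

/-- The `τ`-ratio matrix with `N` factors, i.e. `τ^{(2)}_{N-1}(t,s)`:
the descending product of `(H_m^t)⁻¹ H_m^s` over `0 ≤ m ≤ N - 1`. -/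
def tau₂ {p : ℕ} (u : MatrixKernel p) (N : ℕ) (t s : Times) : Mat p :=
  descProd (fun m => (quasitau u t m)⁻¹ * quasitau u s m) N

/-! ### Contour integrals of matrix functions -/

/-- Entrywise integrability over the circle `|z| = r`. -/
def CircleInt {p : ℕ} (r : ℝ) (F : ℂ → Mat p) : Prop :=
  ∀ i j, CircleIntegrable (fun z => F z i j) 0 r

/-- The contour integral `∮_{|z| = r} F(z) dz`, entry by entry. -/
def matCircle {p : ℕ} (r : ℝ) (F : ℂ → Mat p) : Mat p :=
  Matrix.of fun i j => circleIntegral (fun z => F z i j) 0 r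

/-- Equality of two contour integrals, both of which exist:
`∮_{|z| = r₁} F(z) dz = ∮_{|z| = r₂} E(z) dz`. -/
structure CircleEq {p : ℕ} (r₁ : ℝ) (F : ℂ → Mat p) (r₂ : ℝ) (E : ℂ → Mat p) : Prop where
  int₁ : CircleInt r₁ F
  int₂ : CircleInt r₂ E
  eq : matCircle r₁ F = matCircle r₂ E

end

end GUBilinear

open GUBilinear

/-! The identities are two evaluations of one pairing. If the circle `|z| = r` encloses the values
of a coordinate `ℓ` on the support of `T`, and `f` is entire, then `∮ f(z) ⟨T, (z - ℓ)⁻¹ g⟩ dz = 2πi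
⟨T, f(ℓ) g⟩` (`circleIntegral_mul_pair`): expand the Cauchy kernel geometrically in `ℓ / z`, use
continuity of `T` along power series (`hasSum_pair`), and recognise the Taylor coefficients of `f`.
So, up to the constant factor `(H_l)⁻¹` in the Baker form, the left integrals collapse to `2πi
⟨e^{t₁'} P̂_k W_C, e^{-t₂} P_l^{[2]}⟩_u` and the right ones to `2πi ⟨e^{t₁'} P̂_k, e^{-t₂} P_l^{[2]}
W_Gᵀ⟩_û`. These agree because `û W_G = W_C u` (`IsGeronimusUvarov.sesq_eq`).

The `τ`-ratio form rests on biorthogonality. Since `e^{∑ x^j / (j z^j)} = (1 - x/z)⁻¹`, a Miwa shift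
multiplies or divides the kernel by a linear factor, and the two Gram matrices satisfy `G'_{kl} =
G_{kl} - z⁻¹ G_{k+1,l}`. Then `(1 - x/z) P'_n + z⁻¹ P_{n+1} = H'_n H_n⁻¹ P_n`
(`IsGaussBorel.connection`). At `x = z` this iterates to a product formula for `P_n(z)`; paired with
the dual polynomials it iterates to one for the second kind functions. The `y`-variable follows by
transposing the Gram matrix. Substituting the four product formulas into the identity for
polynomials and second kind functions gives the last one. -/

open Filter Set

namespace GUBilinear

/-! ### Pairing distributions with functions smooth near their support -/

/-- `f` is smooth in a neighbourhood of `K`. -/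
def SmoothNear (K : Set (ℂ × ℂ)) (f : ℂ × ℂ → ℂ) : Prop :=
  ∀ᶠ q in 𝓝ˢ K, ContDiffAt ℝ ∞ f q

namespace SmoothNear

variable {K : Set (ℂ × ℂ)} {f g : ℂ × ℂ → ℂ}

theorem of_contDiff (hf : ContDiff ℝ ∞ f) : SmoothNear K f :=
  Eventually.of_forall fun _ => hf.contDiffAt

theorem mono {K' : Set (ℂ × ℂ)} (hf : SmoothNear K f) (h : K' ⊆ K) : SmoothNear K' f :=
  Filter.Eventually.filter_mono (nhdsSet_mono h) hf

theorem mul (hf : SmoothNear K f) (hg : SmoothNear K g) :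
    SmoothNear K (fun q => f q * g q) := by
  filter_upwards [hf, hg] with q h1 h2 using h1.mul h2

theorem const (c : ℂ) : SmoothNear K (fun _ => c) := of_contDiff contDiff_const

theorem sum {ι : Type*} (s : Finset ι) {F : ι → ℂ × ℂ → ℂ} (h : ∀ i ∈ s, SmoothNear K (F i)) :
    SmoothNear K (fun q => ∑ i ∈ s, F i q) := by
  have : ∀ᶠ q in 𝓝ˢ K, ∀ i ∈ s, ContDiffAt ℝ ∞ (F i) q :=
    (Filter.eventually_all_finset s).2 h
  filter_upwards [this] with q hq
  exact ContDiffAt.sum hq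

theorem congr (hf : SmoothNear K f) (h : f =ᶠ[𝓝ˢ K] g) : SmoothNear K g := by
  have h' : ∀ᶠ q in 𝓝ˢ K, f =ᶠ[𝓝 q] g := by
    obtain ⟨U, hU, hKU, hfg⟩ := eventually_nhdsSet_iff_exists.1 h
    exact eventually_nhdsSet_iff_exists.2
      ⟨U, hU, hKU, fun q hq => Filter.eventually_of_mem (hU.mem_nhds hq) hfg⟩
  filter_upwards [hf, h'] with q h1 h2 using h1.congr_of_eventuallyEq h2.symm

end SmoothNear

/-- A distribution kills test functions vanishing near its support. -/
theorem apply_eq_zero_of_eventuallyEq_zero (T : Kernel) (φ : Test)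
    (h : (φ : ℂ × ℂ → ℂ) =ᶠ[𝓝ˢ (Distribution.dsupport T)] 0) : T φ = 0 := by
  have hdisj : ∀ q ∈ tsupport φ, q ∉ Distribution.dsupport T := by
    intro q hq hqT
    have := h.filter_mono (nhds_le_nhdsSet hqT)
    exact (notMem_tsupport_iff_eventuallyEq.2 this) hq
  have hV : ∀ q ∈ tsupport φ, ∃ s : Set (ℂ × ℂ),
      Distribution.IsVanishingOn T s ∧ IsOpen s ∧ q ∈ s :=
    fun q hq => (Distribution.notMem_dsupport_iff q).1 (hdisj q hq)
  choose! s hs1 hs2 hs3 using hV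
  have hc : IsCompact (tsupport φ) := φ.hasCompactSupport
  obtain ⟨b, hbs, hb⟩ := hc.elim_nhds_subcover s fun q hq => (hs2 q hq).mem_nhds (hs3 q hq)
  -- Finitely many open sets on which `T` vanishes cover `tsupport φ`. A subordinate partition of
  -- unity splits `φ` into pieces each killed by `T`.
  obtain ⟨ρ, hρ⟩ := SmoothPartitionOfUnity.exists_isSubordinate (modelWithCornersSelf ℝ (ℂ × ℂ))
    (isClosed_tsupport φ) (fun i : b => s i) (fun i => hs2 _ (hbs _ i.2))
    (by simpa [Set.iUnion_subtype] using hb)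
  have hsm : ∀ i, ContDiff ℝ ∞ (fun q => ((ρ i q : ℝ) : ℂ)) := fun i =>
    Complex.ofRealCLM.contDiff.comp (ρ i).contMDiff.contDiff
  have hsum : φ = ∑ i, mulTest _ (hsm i) φ := by
    ext q
    have e : (∑ i, mulTest _ (hsm i) φ : Test) q = ∑ i, ((ρ i q : ℝ) : ℂ) * φ q := by
      let c : Test →+ ℂ := ⟨⟨fun φ => φ q, rfl⟩, fun _ _ => rfl⟩
      exact map_sum c (fun i => mulTest _ (hsm i) φ) _
    rw [e, ← Finset.sum_mul]
    by_cases hq : q ∈ tsupport φ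
    · have := ρ.sum_eq_one hq
      rw [finsum_eq_sum_of_fintype] at this
      rw [← Complex.ofReal_sum, this]; simp
    · rw [image_eq_zero_of_notMem_tsupport hq]; simp
  rw [hsum, map_sum]
  refine Finset.sum_eq_zero fun i _ => hs1 i (hbs _ i.2) _ ?_
  refine subset_trans ?_ (hρ i)
  have : tsupport (fun q => ((ρ i q : ℝ) : ℂ) * φ q) ⊆ tsupport (fun q => ((ρ i q : ℝ) : ℂ)) :=
    tsupport_mul_subset_left
  refine this.trans (closure_mono fun q hq => ?_)
  simpa using hq

/-- A function smooth near a compact set agrees there with a test function. -/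
theorem SmoothNear.exists_test {K U : Set (ℂ × ℂ)} (hK : IsCompact K) (hU : IsOpen U)
    (hKU : K ⊆ U) {f : ℂ × ℂ → ℂ} (hf : SmoothNear K f) :
    ∃ φ : Test, (φ : ℂ × ℂ → ℂ) =ᶠ[𝓝ˢ K] f ∧ tsupport φ ⊆ U := by
  obtain ⟨V, hV, hKV, hfV⟩ := eventually_nhdsSet_iff_exists.1 hf
  obtain ⟨L, hL, hKL, hLV⟩ := exists_compact_between hK (hU.inter hV) (subset_inter hKU hKV)
  obtain ⟨χ, h1, h0, -⟩ := exists_contMDiffMap_one_nhds_of_subset_interior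
    (n := ⊤) (modelWithCornersSelf ℝ (ℂ × ℂ)) hK.isClosed hKL
  have hχ : ContDiff ℝ ∞ (fun q => ((χ q : ℝ) : ℂ)) :=
    Complex.ofRealCLM.contDiff.comp χ.contMDiff.contDiff
  have hts : tsupport (fun q => ((χ q : ℝ) : ℂ) * f q) ⊆ L := by
    refine closure_minimal (fun q hq => ?_) hL.isClosed
    by_contra hqL
    exact hq (by simp [h0 q hqL])
  refine ⟨⟨fun q => ((χ q : ℝ) : ℂ) * f q, ?_, ?_, fun _ _ => trivial⟩, ?_, ?_⟩
  · rw [contDiff_iff_contDiffAt]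
    intro q
    by_cases hq : q ∈ L
    · exact hχ.contDiffAt.mul (hfV q (hLV hq).2)
    · have : (fun q => ((χ q : ℝ) : ℂ) * f q) =ᶠ[𝓝 q] 0 :=
        notMem_tsupport_iff_eventuallyEq.1 fun h => hq (hts h)
      exact (contDiffAt_const (c := (0 : ℂ))).congr_of_eventuallyEq this
  · exact hL.of_isClosed_subset (isClosed_tsupport _) hts
  · filter_upwards [h1] with q hq
    change ((χ q : ℝ) : ℂ) * f q = f q
    simp [hq]
  · exact hts.trans (hLV.trans inter_subset_left)

/-- The choice made in `pair` is immaterial: two admissible test functions differ by one that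
vanishes near the support of `T`. -/
theorem pair_eq {T : Kernel} {φ : Test} {f : ℂ × ℂ → ℂ}
    (h : (φ : ℂ × ℂ → ℂ) =ᶠ[𝓝ˢ (Distribution.dsupport T)] f) : pair T f = T φ := by
  have hex : ∃ φ : Test, (φ : ℂ × ℂ → ℂ) =ᶠ[𝓝ˢ (Distribution.dsupport T)] f := ⟨φ, h⟩
  rw [pair, dif_pos hex, ← sub_eq_zero, ← map_sub]
  refine apply_eq_zero_of_eventuallyEq_zero T _ ?_
  filter_upwards [hex.choose_spec, h] with q h1 h2
  rw [IsSubApply.sub_apply]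
  simp [h1, h2]

/-- No smoothness is needed: a test function representing `f` also represents `g`, and if there is
none both pairings take the default value `0`. -/
theorem pair_congr {T : Kernel} {f g : ℂ × ℂ → ℂ}
    (h : f =ᶠ[𝓝ˢ (Distribution.dsupport T)] g) : pair T f = pair T g := by
  by_cases hex : ∃ φ : Test, (φ : ℂ × ℂ → ℂ) =ᶠ[𝓝ˢ (Distribution.dsupport T)] f
  · obtain ⟨φ, hφ⟩ := hex
    rw [pair_eq hφ, pair_eq (hφ.trans h)]
  · have hex' : ¬ ∃ φ : Test, (φ : ℂ × ℂ → ℂ) =ᶠ[𝓝ˢ (Distribution.dsupport T)] g :=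
      fun ⟨φ, hφ⟩ => hex ⟨φ, hφ.trans h.symm⟩
    rw [pair, pair, dif_neg hex, dif_neg hex']

theorem SmoothNear.exists_test' {T : Kernel} (hT : IsCompact (Distribution.dsupport T))
    {f : ℂ × ℂ → ℂ} (hf : SmoothNear (Distribution.dsupport T) f) :
    ∃ φ : Test, (φ : ℂ × ℂ → ℂ) =ᶠ[𝓝ˢ (Distribution.dsupport T)] f :=
  (SmoothNear.exists_test hT isOpen_univ (subset_univ _) hf).imp fun _ h => h.1

theorem pair_add {T : Kernel} (hT : IsCompact (Distribution.dsupport T)) {f g : ℂ × ℂ → ℂ}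
    (hf : SmoothNear (Distribution.dsupport T) f) (hg : SmoothNear (Distribution.dsupport T) g) :
    pair T (fun q => f q + g q) = pair T f + pair T g := by
  obtain ⟨φ, hφ⟩ := hf.exists_test' hT
  obtain ⟨γ, hγ⟩ := hg.exists_test' hT
  rw [pair_eq hφ, pair_eq hγ, ← map_add]
  refine pair_eq ?_
  filter_upwards [hφ, hγ] with q h1 h2
  rw [IsAddApply.add_apply, h1, h2]

theorem pair_const_mul {T : Kernel} (hT : IsCompact (Distribution.dsupport T)) (c : ℂ)
    {f : ℂ × ℂ → ℂ} (hf : SmoothNear (Distribution.dsupport T) f) :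
    pair T (fun q => c * f q) = c * pair T f := by
  obtain ⟨φ, hφ⟩ := hf.exists_test' hT
  rw [pair_eq hφ, ← smul_eq_mul, ← map_smul]
  refine pair_eq ?_
  filter_upwards [hφ] with q h1
  rw [IsSMulApply.smul_apply, h1, smul_eq_mul]

theorem pair_sum {T : Kernel} (hT : IsCompact (Distribution.dsupport T)) {ι : Type*}
    (s : Finset ι) {F : ι → ℂ × ℂ → ℂ}
    (h : ∀ i ∈ s, SmoothNear (Distribution.dsupport T) (F i)) :
    pair T (fun q => ∑ i ∈ s, F i q) = ∑ i ∈ s, pair T (F i) := by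
  classical
  induction s using Finset.induction_on with
  | empty =>
    have : ((0 : Test) : ℂ × ℂ → ℂ) =ᶠ[𝓝ˢ (Distribution.dsupport T)]
      (fun q => ∑ i ∈ (∅ : Finset ι), F i q) := by
      filter_upwards with q; simp
    rw [pair_eq this]; simp
  | insert a s ha ih =>
    simp only [Finset.sum_insert ha]
    rw [pair_add hT (h a (by simp)) (SmoothNear.sum s fun i hi => h i (by simp [hi])),
      ih fun i hi => h i (by simp [hi])]

/-! ### Power series and Cauchy's formula under a distribution -/

/-- Continuity of distributions along series converging with all derivatives on a compact set. -/
theorem hasSum_apply (T : Kernel) {L : Set (ℂ × ℂ)} (hL : IsCompact L) (F : ℕ → Test) (Φ : Test)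
    (hF : ∀ n, tsupport (F n) ⊆ L) (hΦL : tsupport Φ ⊆ L) (v : ℕ → ℕ → ℝ)
    (hv : ∀ k, Summable (v k)) (hb : ∀ k n q, ‖iteratedFDeriv ℝ k (F n) q‖ ≤ v k n)
    (hΦ : ∀ q, Φ q = ∑' n, F n q) : HasSum (fun n => T (F n)) (T Φ) := by
  let K : TopologicalSpace.Compacts (ℂ × ℂ) := ⟨L, hL⟩
  have hK : (K : Set (ℂ × ℂ)) ⊆ ((⊤ : TopologicalSpace.Opens (ℂ × ℂ)) : Set (ℂ × ℂ)) :=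
    fun _ _ => trivial
  let f : ℕ → ContDiffMapSupportedIn (ℂ × ℂ) ℂ ⊤ K := fun n =>
    ContDiffMapSupportedIn.of_support_subset (F n).contDiff ((subset_tsupport _).trans (hF n))
  let φ : ContDiffMapSupportedIn (ℂ × ℂ) ℂ ⊤ K :=
    ContDiffMapSupportedIn.of_support_subset Φ.contDiff ((subset_tsupport _).trans hΦL)
  have hfφ : HasSum f φ := by
    rw [HasSum, SummationFilter.unconditional_filter,
      (ContDiffMapSupportedIn.withSeminorms ℝ (ℂ × ℂ) ℂ ⊤ K).tendsto_nhds]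
    intro k ε hε
    -- By the Weierstrass test the series of `k`-th derivatives converges uniformly. The margin `ε /
    -- 2` restores a strict inequality after passing to the seminorm, which is only bounded by `≤`.
    have hu := Metric.tendstoUniformly_iff.1
      (tendstoUniformly_tsum (hv k) fun n q => hb k n q) (ε / 2) (half_pos hε)
    filter_upwards [hu] with s hs
    refine lt_of_le_of_lt ?_ (half_lt_self hε)
    rw [ContDiffMapSupportedIn.seminorm_top_le_iff ℝ (half_pos hε).le]
    intro q _
    have hq := (hs q).le
    rw [← iteratedFDeriv_tsum_apply (N := ⊤) (v := v) (fun n => (F n).contDiff)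
      (fun k _ => hv k) (fun k n q _ => hb k n q) le_top, ← funext hΦ, dist_comm,
      dist_eq_norm] at hq
    have hcoe : ((∑ n ∈ s, f n - φ : ContDiffMapSupportedIn (ℂ × ℂ) ℂ ⊤ K) : ℂ × ℂ → ℂ) =
        (fun q => ∑ n ∈ s, F n q) - Φ := by
      let c : ContDiffMapSupportedIn (ℂ × ℂ) ℂ ⊤ K →+ (ℂ × ℂ → ℂ) :=
        ⟨⟨fun g => (g : ℂ × ℂ → ℂ), rfl⟩, fun _ _ => rfl⟩
      have := map_sub c (∑ n ∈ s, f n) φ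
      rw [map_sum] at this
      refine this.trans ?_
      ext q
      simp only [Pi.sub_apply, Finset.sum_apply]
      rfl
    rw [hcoe, iteratedFDeriv_sub_apply, iteratedFDeriv_fun_sum_apply]
    · exact hq
    · exact fun n _ => (F n).contDiff.contDiffAt.of_le (by exact_mod_cast le_top)
    · exact ContDiffAt.sum fun n _ => (F n).contDiff.contDiffAt.of_le (by exact_mod_cast le_top)
    · exact Φ.contDiff.contDiffAt.of_le (by exact_mod_cast le_top)
  -- Convergence takes place among functions supported in the fixed compact `K`, whose inclusion
  -- into the test functions is continuous; then `T` is applied.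
  have h := (hfφ.mapL (TestFunction.ofSupportedInCLM ℂ hK)).mapL T
  exact h

/-- A Cauchy-type estimate: each derivative costs a constant independent of `n`, at the price of
enlarging `‖ℓ q‖` by `ε`. Hence every derivative of a power series in `ℓ` is dominated by the series
at a slightly larger radius. -/
theorem norm_iteratedFDeriv_clm_pow_le (ℓ : ℂ × ℂ →L[ℝ] ℂ) (hℓ : ‖ℓ‖ ≤ 1) {ε : ℝ} (hε : 0 < ε)
    (k n : ℕ) (q : ℂ × ℂ) :
    ‖iteratedFDeriv ℝ k (fun q => ℓ q ^ n) q‖ ≤ k.factorial * (ε ^ k)⁻¹ * (‖ℓ q‖ + ε) ^ n := by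
  induction n generalizing k with
  | zero =>
    simp only [pow_zero]
    rcases k with _ | k
    · simp
    · rw [iteratedFDeriv_const_of_ne (by simp)]
      simp only [Pi.zero_apply, norm_zero]; positivity
  | succ n ih =>
    have h0 : ‖iteratedFDeriv ℝ 0 ℓ q‖ = ‖ℓ q‖ := norm_iteratedFDeriv_zero
    have h1 : ‖iteratedFDeriv ℝ 1 ℓ q‖ ≤ 1 := by
      rw [norm_iteratedFDeriv_one, ℓ.fderiv]; exact hℓ
    have h2 : ∀ j, ‖iteratedFDeriv ℝ (j + 2) ℓ q‖ = 0 := by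
      intro j
      rw [← norm_iteratedFDeriv_fderiv]
      have : fderiv ℝ ℓ = fun _ => ℓ := by ext1 x; exact ℓ.fderiv
      rw [this, iteratedFDeriv_const_of_ne (by simp)]; simp
    have hm := norm_iteratedFDeriv_mul_le (N := ∞) ℓ.contDiff
      (g := fun q => ℓ q ^ n) (ℓ.contDiff.pow n) q (n := k) (by exact_mod_cast le_top)
    simp only [pow_succ'] at hm ⊢
    refine hm.trans ?_
    rcases k with _ | k
    · simp only [zero_add, Finset.sum_range_one, Nat.choose_self, h0]
      have := ih 0
      simp at this ⊢
      gcongr; linarith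
    -- In the Leibniz sum for `ℓ * ℓ ^ n` only the terms with zero or one derivative on the linear
    -- map `ℓ` survive.
    · rw [Finset.sum_range_succ', Finset.sum_range_succ', Finset.sum_eq_zero]
      · simp only [h0, zero_add, Nat.choose_one_right, Nat.choose_zero_right, Nat.sub_zero]
        have i1 := ih (k + 1)
        have i2 := ih k
        calc _ ≤ ((k + 1 : ℕ) : ℝ) * 1 * (k.factorial * (ε ^ k)⁻¹ * (‖ℓ q‖ + ε) ^ n) +
              1 * ‖ℓ q‖ * ((k + 1).factorial * (ε ^ (k + 1))⁻¹ * (‖ℓ q‖ + ε) ^ n) := by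
              rw [Nat.cast_one]
              have h4 : k + 1 - (0 + 1) = k := by omega
              rw [h4]
              gcongr
          _ = _ := by
            rw [Nat.factorial_succ]; push_cast; field_simp; ring
      · intro j _
        rw [h2]; simp

/-- Pairing with a power series in a coordinate, multiplied by a smooth function. -/
theorem hasSum_pair {T : Kernel} (hT : IsCompact (Distribution.dsupport T)) (ℓ : ℂ × ℂ →L[ℝ] ℂ)
    (hℓ : ‖ℓ‖ ≤ 1) {r : ℝ} (hr : 0 < r) (hTr : ∀ q ∈ Distribution.dsupport T, ‖ℓ q‖ < r)
    {g : ℂ × ℂ → ℂ} (hg : SmoothNear (Distribution.dsupport T) g) {h : ℂ → ℂ} {a : ℕ → ℂ}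
    (hd : DifferentiableOn ℂ h (Metric.ball 0 r))
    (ha : ∀ w, ‖w‖ < r → HasSum (fun n => a n * w ^ n) (h w)) :
    HasSum (fun n => a n * pair T (fun q => ℓ q ^ n * g q)) (pair T (fun q => h (ℓ q) * g q)) := by
  have hU : IsOpen {q : ℂ × ℂ | ‖ℓ q‖ < r} := isOpen_lt (by fun_prop) continuous_const
  obtain ⟨ψ, hψ, hψU⟩ := hg.exists_test hT hU hTr
  have hψc : IsCompact (tsupport ψ) := ψ.hasCompactSupport
  obtain ⟨ρ, hρ0, hρr, hρ⟩ : ∃ ρ, 0 ≤ ρ ∧ ρ < r ∧ ∀ q ∈ tsupport ψ, ‖ℓ q‖ ≤ ρ := by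
    rcases (tsupport ψ).eq_empty_or_nonempty with he | hne
    · exact ⟨0, le_rfl, hr, by simp [he]⟩
    · obtain ⟨q, hq, hm⟩ := hψc.exists_isMaxOn hne (f := fun q => ‖ℓ q‖) (by fun_prop)
      exact ⟨‖ℓ q‖, norm_nonneg _, hψU hq, fun q' hq' => hm hq'⟩
  -- With `ε = R - ρ` the derivative estimate is at most a constant times `R ^ n` on the support of
  -- `ψ`, and `R < r` keeps `∑ ‖a n‖ R ^ n` convergent.
  obtain ⟨R, hρR, hRr⟩ := exists_between hρr
  have hε : 0 < R - ρ := sub_pos.2 hρR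
  have hR0 : 0 ≤ R := hρ0.trans hρR.le
  have hsa : Summable (fun n => ‖a n‖ * R ^ n) := by
    have := (ha R (by simpa [abs_of_nonneg hR0] using hRr)).summable.norm
    simpa [abs_of_nonneg hR0] using this
  have hℓs : ∀ n, ContDiff ℝ ∞ (fun q => ℓ q ^ n) := fun n => ℓ.contDiff.pow n
  have hhs : ∀ q, ‖ℓ q‖ < r → ContDiffAt ℝ ∞ (fun q => h (ℓ q)) q := fun q hq => by
    have h1 : ContDiffAt ℂ ∞ h (ℓ q) :=
      (hd.analyticAt (Metric.isOpen_ball.mem_nhds (by simpa using hq))).contDiffAt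
    exact (h1.restrict_scalars ℝ).comp q ℓ.contDiff.contDiffAt
  let F : ℕ → Test := fun n => a n • mulTest _ (hℓs n) ψ
  have hF : ∀ n q, F n q = a n * (ℓ q ^ n * ψ q) := fun n q => rfl
  have hts : ∀ k : ℂ × ℂ → ℂ, tsupport (fun q => k q * ψ q) ⊆ tsupport ψ :=
    fun k => tsupport_mul_subset_right
  let Φ : Test := ⟨fun q => h (ℓ q) * ψ q, by
    rw [contDiff_iff_contDiffAt]
    intro q
    by_cases hq : q ∈ tsupport ψ
    · exact (hhs q (hψU hq)).mul ψ.contDiff.contDiffAt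
    · have : (fun q => h (ℓ q) * ψ q) =ᶠ[𝓝 q] 0 :=
        notMem_tsupport_iff_eventuallyEq.1 fun hq' => hq (hts _ hq')
      exact (contDiffAt_const (c := (0 : ℂ))).congr_of_eventuallyEq this,
    hψc.of_isClosed_subset (isClosed_tsupport _) (hts _), fun _ _ => trivial⟩
  have hΦ : ∀ q, Φ q = h (ℓ q) * ψ q := fun q => rfl
  have hFs : ∀ n, tsupport (F n) ⊆ tsupport ψ := fun n => by
    have : (F n : ℂ × ℂ → ℂ) = fun q => (a n * ℓ q ^ n) * ψ q := by
      ext q; rw [hF]; ring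
    rw [this]; exact hts _
  have hbd : ∀ k, ∃ C : ℝ, ∀ q, ‖iteratedFDeriv ℝ k ψ q‖ ≤ C := fun k =>
    (ψ.contDiff.continuous_iteratedFDeriv
      (by exact_mod_cast le_top)).bounded_above_of_compact_support
      (ψ.hasCompactSupport.iteratedFDeriv k)
  choose C hC using hbd
  let D : ℕ → ℝ := fun k => ∑ j ∈ Finset.range (k + 1),
    (k.choose j : ℝ) * (j.factorial * ((R - ρ) ^ j)⁻¹) * C (k - j)
  have hC0 : ∀ k, 0 ≤ C k := fun k => (norm_nonneg _).trans (hC k 0)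
  have key : HasSum (fun n => T (F n)) (T Φ) := by
    refine hasSum_apply T hψc F Φ hFs (hts _) (fun k n => (‖a n‖ * R ^ n) * D k)
      (fun k => hsa.mul_right _) ?_ ?_
    · intro k n q
      have hD0 : 0 ≤ D k := Finset.sum_nonneg fun j _ => by have := hC0 (k - j); positivity
      by_cases hq : q ∈ tsupport ψ
      · have e : iteratedFDeriv ℝ k (F n) q = a n • iteratedFDeriv ℝ k (fun q => ℓ q ^ n * ψ q) q :=
          iteratedFDeriv_const_smul_apply (a := a n) (((hℓs n).mul ψ.contDiff).contDiffAt.of_le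
            (by exact_mod_cast le_top))
        rw [e, norm_smul, mul_assoc]
        refine mul_le_mul_of_nonneg_left ?_ (norm_nonneg _)
        refine (norm_iteratedFDeriv_mul_le (N := ∞) (hℓs n) ψ.contDiff q
          (by exact_mod_cast le_top)).trans ?_
        rw [Finset.mul_sum]
        refine Finset.sum_le_sum fun j _ => ?_
        have h1 := norm_iteratedFDeriv_clm_pow_le ℓ hℓ hε j n q
        have h2 : (‖ℓ q‖ + (R - ρ)) ^ n ≤ R ^ n := by
          refine pow_le_pow_left₀ (by positivity) ?_ n
          linarith [hρ q hq]
        calc _ ≤ (k.choose j : ℝ) * (j.factorial * ((R - ρ) ^ j)⁻¹ * R ^ n) * C (k - j) := by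
              gcongr
              · exact h1.trans (by gcongr)
              · exact hC _ _
          _ = _ := by ring
      · have : q ∉ tsupport (iteratedFDeriv ℝ k (F n)) :=
          fun hq' => hq (hFs n (tsupport_iteratedFDeriv_subset k hq'))
        rw [image_eq_zero_of_notMem_tsupport this, norm_zero]
        positivity
    · intro q
      rw [hΦ]
      by_cases hq : q ∈ tsupport ψ
      · have := ((ha _ (hψU hq)).mul_right (ψ q)).tsum_eq
        rw [← this]
        exact tsum_congr fun n => by rw [hF]; ring
      · simp [hF, image_eq_zero_of_notMem_tsupport hq]
  convert key using 1
  · ext n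
    rw [← pair_eq (T := T) (φ := F n) (f := fun q => a n * (ℓ q ^ n * g q)), pair_const_mul hT]
    · exact (SmoothNear.of_contDiff (hℓs n)).mul hg
    · filter_upwards [hψ] with q hq
      rw [hF, hq]
  · refine pair_eq ?_
    filter_upwards [hψ] with q hq
    rw [hΦ, hq]

/-- Cauchy's formula under a distribution, for a complex coordinate `ℓ` of `ℂ × ℂ`. -/
theorem circleIntegral_mul_pair {T : Kernel} (hT : IsCompact (Distribution.dsupport T))
    (ℓ : ℂ × ℂ →L[ℝ] ℂ) (hℓ : ‖ℓ‖ ≤ 1) {r : ℝ} (hr : 0 < r)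
    (hTr : ∀ q ∈ Distribution.dsupport T, ‖ℓ q‖ < r)
    {g : ℂ × ℂ → ℂ} (hg : SmoothNear (Distribution.dsupport T) g) {f : ℂ → ℂ}
    (hf : Differentiable ℂ f) :
    CircleIntegrable (fun z => f z * pair T (fun q => (z - ℓ q)⁻¹ * g q)) 0 r ∧
    (∮ z in C(0, r), f z * pair T (fun q => (z - ℓ q)⁻¹ * g q)) =
      2 * Real.pi * Complex.I * pair T (fun q => f (ℓ q) * g q) := by
  set m : ℕ → ℂ := fun n => pair T (fun q => ℓ q ^ n * g q) with hm
  have hgeo : ∀ z : ℂ, ‖z‖ = r →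
      HasSum (fun n => z⁻¹ ^ (n + 1) * m n) (pair T (fun q => (z - ℓ q)⁻¹ * g q)) := by
    intro z hz
    have hz0 : z ≠ 0 := norm_pos_iff.1 (hz ▸ hr)
    have hne : ∀ w : ℂ, ‖w‖ < r → z - w ≠ 0 := fun w hw h => by
      rw [sub_eq_zero] at h; rw [h] at hz; exact hw.ne hz
    refine hasSum_pair hT ℓ hℓ hr hTr hg (h := fun w => (z - w)⁻¹) ?_ ?_
    · intro w hw
      exact ((differentiableAt_const z).sub differentiableAt_id).inv
        (hne w (by simpa using hw)) |>.differentiableWithinAt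
    · intro w hw
      have h1 : ‖z⁻¹ * w‖ < 1 := by
        rw [norm_mul, norm_inv, hz, inv_mul_lt_iff₀ hr, mul_one]; exact hw
      have h2 := (hasSum_geometric_of_norm_lt_one h1).mul_left z⁻¹
      have e1 : (fun n => z⁻¹ ^ (n + 1) * w ^ n) = fun n => z⁻¹ * (z⁻¹ * w) ^ n := by
        ext n; ring
      have e2 : (z - w)⁻¹ = z⁻¹ * (1 - z⁻¹ * w)⁻¹ := by
        rw [← mul_inv, mul_sub, mul_one, mul_inv_cancel_left₀ hz0]
      rw [e1, e2]
      exact h2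
  -- The norms of the terms depend only on `‖z‖`, so convergence at the single point `z = r`
  -- provides a majorant on the whole circle.
  have hmsum : Summable (fun n => r⁻¹ ^ (n + 1) * ‖m n‖) := by
    have := (hgeo r (by simp [abs_of_pos hr])).summable.norm
    simpa [abs_of_pos hr] using this
  have hfc : ContinuousOn f (Metric.sphere 0 r) := hf.continuous.continuousOn
  obtain ⟨B, hB⟩ := (isCompact_sphere (0 : ℂ) r).exists_bound_of_continuousOn hfc
  let S : ℕ → ℂ → ℂ := fun n z => f z * (z⁻¹ ^ (n + 1) * m n)
  have hSc : ∀ n, ContinuousOn (S n) (Metric.sphere 0 r) := fun n => by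
    refine hfc.mul (ContinuousOn.mul (ContinuousOn.pow (continuousOn_inv₀.mono ?_) _)
      continuousOn_const)
    intro z hz h0
    rw [mem_sphere_zero_iff_norm, h0, norm_zero] at hz
    exact hr.ne hz
  have hSb : ∀ n, ∀ z ∈ Metric.sphere (0 : ℂ) r, ‖S n z‖ ≤ B * (r⁻¹ ^ (n + 1) * ‖m n‖) := by
    intro n z hz
    have hz' : ‖z‖ = r := by simpa using hz
    simp only [S, norm_mul, norm_pow, norm_inv, hz']
    exact mul_le_mul_of_nonneg_right (hB z hz) (by positivity)
  have hSsum : ∀ z ∈ Metric.sphere (0 : ℂ) r,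
      HasSum (fun n => S n z) (f z * pair T (fun q => (z - ℓ q)⁻¹ * g q)) := fun z hz =>
    (hgeo z (by simpa using hz)).mul_left _
  have hunif := (tendstoUniformlyOn_tsum_nat (hmsum.mul_left B) hSb).congr_right
    (g := fun z => f z * pair T (fun q => (z - ℓ q)⁻¹ * g q)) fun z hz => (hSsum z hz).tsum_eq
  have hpc : ∀ N, ContinuousOn (fun z => ∑ n ∈ Finset.range N, S n z) (Metric.sphere 0 r) :=
    fun N => continuousOn_finsetSum _ fun n _ => hSc n
  have hcont := hunif.continuousOn (Frequently.of_forall hpc)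
  refine ⟨hcont.circleIntegrable hr.le, ?_⟩
  have hlim := TendstoUniformlyOn.tendsto_circleIntegral_of_continuousOn hr.le
    (Eventually.of_forall hpc) hunif
  have hfs := hf.differentiableOn.hasFPowerSeriesOnBall (c := 0) (R := ⟨r, hr.le⟩) hr
  -- The Taylor coefficients of `f` are taken as Cauchy integrals over the same circle, so this
  -- expansion of the right side matches the integrated geometric series term by term.
  have hpow := hasSum_pair hT ℓ hℓ hr hTr hg (h := f)
    (a := fun n => (2 * Real.pi * Complex.I : ℂ)⁻¹ * ∮ z in C(0, r), f z * z⁻¹ ^ (n + 1))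
    hf.differentiableOn (fun w hw => by
      have := hfs.hasSum (y := w) (by
        rw [Metric.mem_eball, edist_zero_right]
        exact ENNReal.coe_lt_coe.2 (NNReal.coe_lt_coe.1 hw))
      rw [zero_add] at this
      refine (?_ : _ = fun n => _ * w ^ n) ▸ this
      funext n
      have e : (fun _ : Fin n => w) = fun i => w • (1 : ℂ) := by simp
      rw [e, ContinuousMultilinearMap.map_smul_univ, cauchyPowerSeries_apply]
      simp only [Finset.prod_const, Finset.card_univ, Fintype.card_fin, smul_eq_mul, sub_zero,
        one_div]
      rw [mul_comm]
      congr 2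
      refine congrArg (fun k : ℂ → ℂ => circleIntegral k 0 r) (funext fun z => ?_)
      ring)
  have hpow' := (hpow.mul_left (2 * Real.pi * Complex.I)).tendsto_sum_nat
  refine tendsto_nhds_unique hlim (hpow'.congr fun N => ?_)
  rw [circleIntegral.integral_fun_sum fun n _ => (hSc n).circleIntegrable hr.le]
  refine Finset.sum_congr rfl fun n _ => ?_
  have e : ∀ z, S n z = m n * (f z * z⁻¹ ^ (n + 1)) := fun z => by simp only [S]; ring
  simp only [e, circleIntegral.integral_const_mul]
  rw [← mul_assoc, ← mul_assoc, mul_inv_cancel₀ Complex.two_pi_I_ne_zero, one_mul, mul_comm]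

/-! ### Gauss–Borel factorization of quasidefinite block matrices -/

variable {p : ℕ}

/-- The block transpose of a semi-infinite block matrix. -/
def blockTranspose (G : ℕ → ℕ → Mat p) : ℕ → ℕ → Mat p := fun k l => (G l k).transpose

theorem Quasidefinite.blockTranspose {G : ℕ → ℕ → Mat p} (hG : Quasidefinite G) :
    Quasidefinite (blockTranspose G) := by
  intro k
  rw [← Matrix.det_transpose]
  exact hG k

/-- Each scalar row of `q` is a left null vector of an invertible truncation. This is the uniqueness
principle for polynomials of degree below `N` with prescribed moments. -/
theorem Quasidefinite.eq_zero {G : ℕ → ℕ → Mat p} (hG : Quasidefinite G) {N : ℕ} {q : ℕ → Mat p}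
    (h : ∀ j < N, ∑ i ∈ Finset.range N, q i * G i j = 0) : ∀ i < N, q i = 0 := by
  intro i hi
  ext a b
  have h0 : (fun s : Fin N × Fin p => q s.1 a s.2) = 0 := by
    refine Matrix.eq_zero_of_vecMul_eq_zero (hG N) ?_
    ext ⟨j, d⟩
    have := congrFun (congrFun (h j j.2) a) d
    rw [Finset.sum_range, Matrix.sum_apply] at this
    simp only [Matrix.mul_apply] at this
    simpa [Matrix.vecMul, dotProduct, Fintype.sum_prod_type] using this
  exact congrFun h0 (⟨i, hi⟩, b)

theorem Quasidefinite.exists_row {G : ℕ → ℕ → Mat p} (hG : Quasidefinite G) (N : ℕ)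
    (R : ℕ → Mat p) : ∃ q : ℕ → Mat p, ∀ j < N, ∑ i ∈ Finset.range N, q i * G i j = R j := by
  set M : Matrix (Fin N × Fin p) (Fin N × Fin p) ℂ := Matrix.of fun a b => G a.1 b.1 a.2 b.2 with hM
  let x : Fin p → Fin N × Fin p → ℂ := fun a =>
    Matrix.vecMul (fun s : Fin N × Fin p => R s.1 a s.2) M⁻¹
  refine ⟨fun i => Matrix.of fun a b => if h : i < N then x a (⟨i, h⟩, b) else 0, fun j hj => ?_⟩
  ext a d
  have hx : Matrix.vecMul (x a) M = fun s : Fin N × Fin p => R s.1 a s.2 := by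
    simp only [x]
    rw [Matrix.vecMul_vecMul, Matrix.nonsing_inv_mul _ (Ne.isUnit (hG N)), Matrix.vecMul_one]
  have := congrFun hx (⟨j, hj⟩, d)
  simp only at this
  rw [← this, Finset.sum_range, Matrix.sum_apply]
  simp [Matrix.vecMul, dotProduct, Fintype.sum_prod_type, Matrix.mul_apply, hM]

theorem Quasidefinite.exists_unitriangular {G : ℕ → ℕ → Mat p} (hG : Quasidefinite G) :
    ∃ S : ℕ → ℕ → Mat p, LowerUnitriangular S ∧
      ∀ n, ∀ j < n, ∑ i ∈ Finset.range (n + 1), S n i * G i j = 0 := by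
  choose s hs using fun n => hG.exists_row n (fun j => -G n j)
  refine ⟨fun n i => if i < n then s n i else if i = n then 1 else 0, ⟨fun n => by simp,
    fun n m h => by simp [h.not_gt, h.ne']⟩, fun n j hj => ?_⟩
  have e : ∀ i ∈ Finset.range n, (if i < n then s n i else if i = n then 1 else 0) * G i j =
      s n i * G i j := fun i hi => by rw [if_pos (Finset.mem_range.1 hi)]
  rw [Finset.sum_range_succ, Finset.sum_congr rfl e, hs n j hj]
  simp

/-- Orthogonalizing the rows of `G` and of its block transpose gives `S` and `R`. The product is
then zero below the diagonal because of `S` and above it because of `R`, so it is block diagonal. -/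
theorem Quasidefinite.exists_isGaussBorel {G : ℕ → ℕ → Mat p} (hG : Quasidefinite G) :
    ∃ F, IsGaussBorel G F := by
  obtain ⟨S, hS, hS0⟩ := hG.exists_unitriangular
  obtain ⟨R, hR, hR0⟩ := hG.blockTranspose.exists_unitriangular
  refine ⟨⟨S, R, fun n => ∑ i ∈ Finset.range (n + 1), S n i * G i n⟩, hS, hR, fun k l => ?_⟩
  have hR1 : ∀ n, ∀ i < n, ∑ j ∈ Finset.range (n + 1), G i j * (R n j).transpose = 0 := by
    intro n i hi
    have := congrArg Matrix.transpose (hR0 n i hi)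
    simpa [Matrix.transpose_sum, GUBilinear.blockTranspose] using this
  rcases lt_trichotomy k l with h | h | h
  · rw [if_neg h.ne]
    refine Finset.sum_eq_zero fun i hi => ?_
    simp only [mul_assoc]
    rw [← Finset.mul_sum, hR1 l i (by simp at hi; omega), mul_zero]
  · subst h
    rw [if_pos rfl, Finset.sum_comm]
    simp only [← Finset.sum_mul]
    rw [Finset.sum_range_succ, Finset.sum_eq_zero, hR.1]
    · simp
    · intro j hj
      rw [hS0 k j (Finset.mem_range.1 hj), zero_mul]
  · rw [if_neg h.ne', Finset.sum_comm]
    simp only [← Finset.sum_mul]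
    refine Finset.sum_eq_zero fun j hj => ?_
    rw [hS0 k j (by simp at hj; omega), zero_mul]

theorem Quasidefinite.gaussBorel {G : ℕ → ℕ → Mat p} (hG : Quasidefinite G) :
    IsGaussBorel G (gaussBorel G) := by
  rw [GUBilinear.gaussBorel, dif_pos hG.exists_isGaussBorel]
  exact hG.exists_isGaussBorel.choose_spec

/-- The factors of the transposed matrix. -/
def Factors.transpose (F : Factors p) : Factors p := ⟨F.S₂, F.S₁, fun n => (F.H n).transpose⟩

namespace IsGaussBorel

variable {G G' : ℕ → ℕ → Mat p} {F F' : Factors p}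

theorem transpose (h : IsGaussBorel G F) : IsGaussBorel (blockTranspose G) F.transpose := by
  refine ⟨h.lower₂, h.lower₁, fun k l => ?_⟩
  have := congrArg Matrix.transpose (h.eq l k)
  rw [Finset.sum_comm]
  simp only [Matrix.transpose_sum, Matrix.transpose_mul, Matrix.transpose_transpose] at this
  simp only [Factors.transpose, blockTranspose, mul_assoc]
  rw [this]
  by_cases hkl : k = l
  · simp [hkl]
  · simp [hkl, Ne.symm hkl]

/-- Orthogonality against monomials instead of dual polynomials: the unitriangular factor `S₂ᵀ` is
removed by induction on the column. -/
theorem row (h : IsGaussBorel G F) {k l : ℕ} (hl : l ≤ k) :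
    ∑ i ∈ Finset.range (k + 1), F.S₁ k i * G i l = if l = k then F.H k else 0 := by
  induction l using Nat.strong_induction_on with
  | _ l ih =>
    have e := h.eq k l
    rw [Finset.sum_comm] at e
    simp only [← Finset.sum_mul] at e
    rw [Finset.sum_range_succ, Finset.sum_eq_zero, h.lower₂.1] at e
    · simpa [eq_comm] using e
    · intro j hj
      have hj' := Finset.mem_range.1 hj
      rw [ih j hj' (by omega), if_neg (by omega), zero_mul]

/-- A left null vector `w` of `H n` makes `w P_n` orthogonal to all monomials of degree at most `n`;
quasidefiniteness kills it, and its leading coefficient is `w`. -/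
theorem isUnit_det (h : IsGaussBorel G F) (hG : Quasidefinite G) (n : ℕ) :
    IsUnit (F.H n).det := by
  rw [isUnit_iff_ne_zero]
  intro h0
  obtain ⟨w, hw, hwH⟩ := Matrix.exists_vecMul_eq_zero_iff.2 h0
  let W : Mat p := Matrix.of fun _ => w
  have hW : W * F.H n = 0 := by
    ext a b
    have := congrFun hwH b
    simpa [Matrix.mul_apply, Matrix.vecMul, dotProduct, W] using this
  have := hG.eq_zero (N := n + 1) (q := fun i => W * F.S₁ n i) (fun j hj => by
    simp only [mul_assoc]
    rw [← Finset.mul_sum, h.row (Nat.lt_succ_iff.1 hj)]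
    split_ifs
    · exact hW
    · simp) n (Nat.lt_succ_self n)
  simp only [h.lower₁.1, mul_one] at this
  exact hw (funext fun a => congrFun (congrFun this a) a)

/-! ### Connection formulas and products of quasitau ratios -/

/-- The connection formula for a kernel multiplied by `1 - c x`, applied to a sequence `g`. -/
theorem connection (hG : Quasidefinite G) (hF : IsGaussBorel G F)
    (hF' : IsGaussBorel G' F') {c : ℂ} (hc : ∀ k l, G' k l = G k l - c • G (k + 1) l) (n : ℕ)
    (g : ℕ → Mat p) :
    ∑ i ∈ Finset.range (n + 1), F'.S₁ n i * (g i - c • g (i + 1)) +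
      c • ∑ i ∈ Finset.range (n + 2), F.S₁ (n + 1) i * g i =
    F'.H n * (F.H n)⁻¹ * ∑ i ∈ Finset.range (n + 1), F.S₁ n i * g i := by
  set A := F'.H n * (F.H n)⁻¹ with hA
  -- Coefficient of `x ^ i` in `(1 - c x) P'_n + c P_{n+1} - A P_n`. The factor `A` is forced by
  -- orthogonality against degree `n`.
  let D : ℕ → Mat p := fun i =>
    F'.S₁ n i - c • (if i = 0 then 0 else F'.S₁ n (i - 1)) + c • F.S₁ (n + 1) i - A * F.S₁ n i
  -- Both monic leading terms contribute at degree `n + 1`, as `-c` and `c`, and cancel; the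
  -- remaining polynomial has degree at most `n`.
  have hlast : D (n + 1) = 0 := by
    simp [D, hF.lower₁.1, hF'.lower₁.1, hF.lower₁.2 n (n + 1) (by omega),
      hF'.lower₁.2 n (n + 1) (by omega)]
  have hD : ∀ g : ℕ → Mat p, ∑ i ∈ Finset.range (n + 1), D i * g i =
      ∑ i ∈ Finset.range (n + 1), F'.S₁ n i * (g i - c • g (i + 1)) +
        c • ∑ i ∈ Finset.range (n + 2), F.S₁ (n + 1) i * g i -
      A * ∑ i ∈ Finset.range (n + 1), F.S₁ n i * g i := by
    intro g
    have e1 : ∑ i ∈ Finset.range (n + 1), D i * g i = ∑ i ∈ Finset.range (n + 2), D i * g i := by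
      rw [Finset.sum_range_succ _ (n + 1), hlast]; simp
    have e2 : ∑ i ∈ Finset.range (n + 1), F'.S₁ n i * g i =
        ∑ i ∈ Finset.range (n + 2), F'.S₁ n i * g i := by
      rw [Finset.sum_range_succ _ (n + 1), hF'.lower₁.2 n (n + 1) (by omega)]; simp
    have e3 : ∑ i ∈ Finset.range (n + 1), F.S₁ n i * g i =
        ∑ i ∈ Finset.range (n + 2), F.S₁ n i * g i := by
      rw [Finset.sum_range_succ _ (n + 1), hF.lower₁.2 n (n + 1) (by omega)]; simp
    have e4 : ∑ i ∈ Finset.range (n + 1), F'.S₁ n i * g (i + 1) =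
        ∑ i ∈ Finset.range (n + 2), (if i = 0 then 0 else F'.S₁ n (i - 1)) * g i := by
      rw [Finset.sum_range_succ' _ (n + 1)]; simp
    simp only [mul_sub, Finset.sum_sub_distrib, mul_smul_comm, ← Finset.smul_sum]
    rw [e1, e2, e3, e4, Finset.mul_sum, Finset.smul_sum, Finset.smul_sum, ← Finset.sum_sub_distrib,
      ← Finset.sum_add_distrib, ← Finset.sum_sub_distrib]
    refine Finset.sum_congr rfl fun i _ => ?_
    simp only [D, sub_mul, add_mul, smul_mul_assoc, mul_assoc]
  have hD0 : ∀ i < n + 1, D i = 0 := by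
    refine hG.eq_zero fun j hj => ?_
    have hj' := Nat.lt_succ_iff.1 hj
    rw [hD, hF.row (k := n + 1) (l := j) (by omega), hF.row hj', if_neg (by omega)]
    simp only [← hc]
    rw [hF'.row hj']
    by_cases h : j = n
    · simp [h, hA, mul_assoc, Matrix.nonsing_inv_mul _ (hF.isUnit_det hG n)]
    · simp [h]
  rw [← sub_eq_zero, ← hD]
  exact Finset.sum_eq_zero fun i hi => by rw [hD0 i (Finset.mem_range.1 hi), zero_mul]

/-- The connection formula at the zero `x = z` of `1 - x / z` reduces to `P_{n+1}(z) = z H'_n H_n⁻¹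
P_n(z)`. -/
theorem sum_pow_smul_S₁ (hG : Quasidefinite G) (hF : IsGaussBorel G F) (hF' : IsGaussBorel G' F')
    {z : ℂ} (hz : z ≠ 0) (hc : ∀ k l, G' k l = G k l - z⁻¹ • G (k + 1) l) (n : ℕ) :
    ∑ i ∈ Finset.range (n + 1), z ^ i • F.S₁ n i =
      z ^ n • descProd (fun m => F'.H m * (F.H m)⁻¹) n := by
  induction n with
  | zero => simp [descProd, hF.lower₁.1]
  | succ n ih =>
    have h := connection hG hF hF' hc n (fun i => z ^ i • 1)
    have h0 : ∀ i : ℕ, z ^ i • (1 : Mat p) - z⁻¹ • z ^ (i + 1) • 1 = 0 := fun i => by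
      rw [smul_smul, pow_succ', inv_mul_cancel_left₀ hz, sub_self]
    simp only [h0, mul_zero, Finset.sum_const_zero, zero_add, mul_smul_comm, mul_one, ih] at h
    rw [inv_smul_eq_iff₀ hz] at h
    rw [h, descProd, smul_smul, pow_succ']

/-- The connection formula is paired with the dual polynomial of degree `l` of the modified kernel.
With `b n = ⟨P_n, P'_l⟩_G` it gives a two-term recursion whose inhomogeneity sits only at `n = l`.
It is run from `b 0`, the wanted moment, up to `b (l + 1) = 0`. -/
theorem descProd_mul_sum (hG : Quasidefinite G) (hF : IsGaussBorel G F)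
    (hF' : IsGaussBorel G' F') {c : ℂ} (hc : ∀ k l, G' k l = G k l - c • G (k + 1) l) (l : ℕ) :
    descProd (fun m => F'.H m * (F.H m)⁻¹) (l + 1) *
      ∑ j ∈ Finset.range (l + 1), G 0 j * (F'.S₂ l j).transpose = c ^ l • F'.H l := by
  let b : ℕ → Mat p := fun n => ∑ i ∈ Finset.range (n + 1), F.S₁ n i *
    ∑ j ∈ Finset.range (l + 1), G i j * (F'.S₂ l j).transpose
  have hb0 : b 0 = ∑ j ∈ Finset.range (l + 1), G 0 j * (F'.S₂ l j).transpose := by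
    simp [b, hF.lower₁.1]
  have hb1 : b (l + 1) = 0 := by
    simp only [b, Finset.mul_sum, ← mul_assoc]
    rw [Finset.sum_comm]
    simp only [← Finset.sum_mul]
    refine Finset.sum_eq_zero fun j hj => ?_
    have := Finset.mem_range.1 hj
    rw [hF.row (k := l + 1) (l := j) (by omega), if_neg (by omega), zero_mul]
  have hrec : ∀ n, F'.H n * (F.H n)⁻¹ * b n = (if n = l then F'.H n else 0) + c • b (n + 1) := by
    intro n
    have h := connection hG hF hF' hc n
      (fun i => ∑ j ∈ Finset.range (l + 1), G i j * (F'.S₂ l j).transpose)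
    rw [← hF'.eq n l]
    simp only [b]
    rw [← h]
    congr 1
    refine Finset.sum_congr rfl fun i _ => ?_
    rw [Finset.smul_sum, ← Finset.sum_sub_distrib, Finset.mul_sum]
    refine Finset.sum_congr rfl fun j _ => ?_
    rw [hc, mul_assoc, sub_mul, smul_mul_assoc]
  have hlow : ∀ n ≤ l, descProd (fun m => F'.H m * (F.H m)⁻¹) n * b 0 = c ^ n • b n := by
    intro n hn
    induction n with
    | zero => simp [descProd]
    | succ n ih =>
      rw [descProd, mul_assoc, ih (by omega), mul_smul_comm, hrec, if_neg (by omega), zero_add,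
        smul_smul, pow_succ]
  rw [← hb0, descProd, mul_assoc, hlow l le_rfl, mul_smul_comm, hrec, if_pos rfl, hb1]
  simp

end IsGaussBorel

/-- Inversion and transposition both reverse the order, so together they preserve descending
products. This carries the formulas for the first variable to the second. -/
theorem descProd_inv (B : ℕ → Mat p) (n : ℕ) :
    (descProd B n)⁻¹ = (descProd (fun m => ((B m)⁻¹).transpose) n).transpose := by
  induction n with
  | zero => simp [descProd]
  | succ n ih => simp [descProd, Matrix.mul_inv_rev, ih]

theorem isUnit_det_descProd {B : ℕ → Mat p} (hB : ∀ m, IsUnit (B m).det) (n : ℕ) :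
    IsUnit (descProd B n).det := by
  induction n with
  | zero => simp [descProd]
  | succ n ih => rw [descProd, Matrix.det_mul]; exact (hB n).mul ih

namespace IsGaussBorel

variable {G G' : ℕ → ℕ → Mat p} {F F' : Factors p}

theorem inv_H_mul_H (hG' : Quasidefinite G') (hF' : IsGaussBorel G' F') (m : ℕ) :
    ((F'.H m)⁻¹ * F.H m)⁻¹.transpose = F'.transpose.H m * (F.transpose.H m)⁻¹ := by
  rw [Matrix.mul_inv_rev, Matrix.nonsing_inv_nonsing_inv _ (hF'.isUnit_det hG' m),
    Matrix.transpose_mul, Matrix.transpose_nonsing_inv]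
  rfl

theorem transpose_sum_pow_smul_S₂ (hG : Quasidefinite G) (hF : IsGaussBorel G F)
    (hG' : Quasidefinite G') (hF' : IsGaussBorel G' F')
    {z : ℂ} (hz : z ≠ 0) (hc : ∀ k l, G' k l = G k l - z⁻¹ • G k (l + 1)) (n : ℕ) :
    (∑ i ∈ Finset.range (n + 1), z ^ i • F.S₂ n i).transpose =
      z ^ n • (descProd (fun m => (F'.H m)⁻¹ * F.H m) n)⁻¹ := by
  have := sum_pow_smul_S₁ hG.blockTranspose hF.transpose hF'.transpose hz
    (fun k l => by simp [blockTranspose, hc]) n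
  rw [descProd_inv]
  simp only [inv_H_mul_H hG' hF']
  rw [← Matrix.transpose_smul, ← this]
  rfl

theorem sum_S₁_mul (hG : Quasidefinite G) (hF : IsGaussBorel G F)
    (hG' : Quasidefinite G') (hF' : IsGaussBorel G' F') {c : ℂ}
    (hc : ∀ k l, G' k l = G k l - c • G k (l + 1)) (l : ℕ) :
    ∑ j ∈ Finset.range (l + 1), F'.S₁ l j * G j 0 =
      c ^ l • (F'.H l * descProd (fun m => (F'.H m)⁻¹ * F.H m) (l + 1)) := by
  have h := congrArg Matrix.transpose (descProd_mul_sum hG.blockTranspose hF.transpose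
    hF'.transpose (c := c) (fun k l => by simp [blockTranspose, hc]) l)
  have hu : ∀ m, IsUnit ((F'.H m)⁻¹ * F.H m).det := fun m => by
    rw [Matrix.det_mul]
    exact (Matrix.isUnit_nonsing_inv_det _ (hF'.isUnit_det hG' m)).mul (hF.isUnit_det hG m)
  simp only [← inv_H_mul_H hG' hF', Matrix.transpose_mul] at h
  rw [← descProd_inv] at h
  have h2 := congrArg (· * descProd (fun m => (F'.H m)⁻¹ * F.H m) (l + 1)) h
  simp only [mul_assoc, Matrix.nonsing_inv_mul _ (isUnit_det_descProd hu (l + 1)), mul_one] at h2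
  simp only [Factors.transpose, Matrix.transpose_sum, Matrix.transpose_mul,
    Matrix.transpose_transpose, Matrix.transpose_smul, blockTranspose, smul_mul_assoc] at h2
  exact h2

end IsGaussBorel

/-! ### Supports and radii -/

theorem dsupport_subset_supp (u : MatrixKernel p) (a b : Fin p) :
    Distribution.dsupport (u a b) ⊆ supp u :=
  subset_iUnion_of_subset a (subset_iUnion_of_subset b subset_rfl)

theorem isCompact_dsupport {u : MatrixKernel p} (hu : IsCompact (supp u)) (a b : Fin p) :
    IsCompact (Distribution.dsupport (u a b)) :=
  hu.of_isClosed_subset Distribution.isClosed_dsupport (dsupport_subset_supp u a b)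

theorem radiusX_nonneg (u : MatrixKernel p) : 0 ≤ radiusX u :=
  Real.sSup_nonneg (by rintro _ ⟨x, -, rfl⟩; exact norm_nonneg x)

theorem radiusY_nonneg (u : MatrixKernel p) : 0 ≤ radiusY u :=
  Real.sSup_nonneg (by rintro _ ⟨x, -, rfl⟩; exact norm_nonneg x)

theorem norm_fst_lt_of_radiusX_lt {u : MatrixKernel p} (hu : IsCompact (supp u)) {r : ℝ}
    (hr : radiusX u < r) {q : ℂ × ℂ} (hq : q ∈ supp u) : ‖q.1‖ < r := by
  refine lt_of_le_of_lt (le_csSup ?_ ?_) hr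
  · exact ((hu.image continuous_fst).image continuous_norm).bddAbove
  · exact mem_image_of_mem _ (mem_image_of_mem _ hq)

theorem norm_snd_lt_of_radiusY_lt {u : MatrixKernel p} (hu : IsCompact (supp u)) {r : ℝ}
    (hr : radiusY u < r) {q : ℂ × ℂ} (hq : q ∈ supp u) : ‖q.2‖ < r := by
  refine lt_of_le_of_lt (le_csSup ?_ ?_) hr
  · exact ((hu.image continuous_snd).image continuous_norm).bddAbove
  · exact mem_image_of_mem _ (mem_image_of_mem _ hq)

theorem eventually_norm_fst_lt {u : MatrixKernel p} (hu : IsCompact (supp u)) {r : ℝ}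
    (hr : radiusX u < r) : ∀ᶠ q in 𝓝ˢ (supp u), ‖q.1‖ < r :=
  (isOpen_lt (by fun_prop) continuous_const).mem_nhdsSet.2
    fun _ hq => norm_fst_lt_of_radiusX_lt hu hr hq

theorem eventually_norm_snd_lt {u : MatrixKernel p} (hu : IsCompact (supp u)) {r : ℝ}
    (hr : radiusY u < r) : ∀ᶠ q in 𝓝ˢ (supp u), ‖q.2‖ < r :=
  (isOpen_lt (by fun_prop) continuous_const).mem_nhdsSet.2
    fun _ hq => norm_snd_lt_of_radiusY_lt hu hr hq

/-! ### Entire matrix functions -/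

/-- Matrix functions with entire entries. -/
def Entire (A : ℂ → Mat p) : Prop := ∀ i j, Differentiable ℂ fun z => A z i j

theorem Entire.mul {A B : ℂ → Mat p} (hA : Entire A) (hB : Entire B) :
    Entire fun z => A z * B z := by
  intro i j
  simp only [Matrix.mul_apply]
  exact Differentiable.fun_sum fun c _ => (hA i c).mul (hB c j)

theorem Entire.smul {f : ℂ → ℂ} {A : ℂ → Mat p} (hf : Differentiable ℂ f) (hA : Entire A) :
    Entire fun z => f z • A z := fun i j => hf.mul (hA i j)

theorem Entire.transpose {A : ℂ → Mat p} (hA : Entire A) : Entire fun z => (A z).transpose :=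
  fun i j => hA j i

theorem entire_mval (W : (Mat p)[X]) : Entire (mval W) := fun i j => (entry W i j).differentiable

theorem entire_P₁ (u : MatrixKernel p) (t : Times) (n : ℕ) : Entire (P₁ u t n) := by
  intro i j
  simp only [P₁, Matrix.sum_apply, Matrix.smul_apply, smul_eq_mul]
  fun_prop

theorem entire_P₂ (u : MatrixKernel p) (t : Times) (n : ℕ) : Entire (P₂ u t n) := by
  intro i j
  simp only [P₂, Matrix.sum_apply, Matrix.smul_apply, smul_eq_mul]
  fun_prop

theorem smoothNear_fst {f : ℂ → ℂ} (hf : Differentiable ℂ f) (K : Set (ℂ × ℂ)) :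
    SmoothNear K fun q => f q.1 :=
  .of_contDiff ((hf.contDiff.restrict_scalars ℝ).comp contDiff_fst)

theorem smoothNear_snd {f : ℂ → ℂ} (hf : Differentiable ℂ f) (K : Set (ℂ × ℂ)) :
    SmoothNear K fun q => f q.2 :=
  .of_contDiff ((hf.contDiff.restrict_scalars ℝ).comp contDiff_snd)

/-! ### Contour integrals of matrix functions -/

theorem CircleInt.mul_const {r : ℝ} {F : ℂ → Mat p} (hF : CircleInt r F) (M : Mat p) :
    CircleInt r fun z => F z * M := by
  intro i j
  simp only [Matrix.mul_apply]
  exact CircleIntegrable.fun_sum _ fun c _ => (hF i c).mul_continuousOn continuousOn_const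

theorem CircleInt.const_mul {r : ℝ} {F : ℂ → Mat p} (hF : CircleInt r F) (M : Mat p) :
    CircleInt r fun z => M * F z := by
  intro i j
  simp only [Matrix.mul_apply]
  exact CircleIntegrable.fun_sum _ fun c _ => (hF c j).continuousOn_mul continuousOn_const

theorem matCircle_mul_const {r : ℝ} {F : ℂ → Mat p} (hF : CircleInt r F) (M : Mat p) :
    matCircle r (fun z => F z * M) = matCircle r F * M := by
  ext i j
  simp only [matCircle, Matrix.of_apply, Matrix.mul_apply]
  refine (circleIntegral.integral_fun_sum (f := fun c z => F z i c * M c j)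
    fun c _ => (hF i c).mul_continuousOn continuousOn_const).trans ?_
  refine Finset.sum_congr rfl fun c _ => ?_
  simp only [mul_comm _ (M c j), circleIntegral.integral_const_mul]

theorem matCircle_const_mul {r : ℝ} {F : ℂ → Mat p} (hF : CircleInt r F) (M : Mat p) :
    matCircle r (fun z => M * F z) = M * matCircle r F := by
  ext i j
  simp only [matCircle, Matrix.of_apply, Matrix.mul_apply]
  refine (circleIntegral.integral_fun_sum (f := fun c z => M i c * F z c j)
    fun c _ => (hF c j).continuousOn_mul continuousOn_const).trans ?_
  simp only [circleIntegral.integral_const_mul]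

theorem CircleInt.congr {r : ℝ} (hr : 0 ≤ r) {F E : ℂ → Mat p} (hF : CircleInt r F)
    (h : ∀ z, ‖z‖ = r → F z = E z) : CircleInt r E := fun i j =>
  (circleIntegrable_congr (fun z hz => by
    rw [abs_of_nonneg hr] at hz
    simp only [h z (by simpa using hz)])).1 (hF i j)

theorem matCircle_congr {r : ℝ} (hr : 0 ≤ r) {F E : ℂ → Mat p}
    (h : ∀ z, ‖z‖ = r → F z = E z) : matCircle r F = matCircle r E := by
  ext i j
  simp only [matCircle, Matrix.of_apply]
  exact circleIntegral.integral_congr hr fun z hz => by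
    rw [h z (mem_sphere_zero_iff_norm.1 hz)]

/-! ### The sesquilinear form -/

@[simp] theorem pair_zero (T : Kernel) : pair T (fun _ => 0) = 0 := by
  have : ((0 : Test) : ℂ × ℂ → ℂ) =ᶠ[𝓝ˢ (Distribution.dsupport T)] fun _ => 0 :=
    Eventually.of_forall fun _ => rfl
  rw [pair_eq this, map_zero]

theorem sesq_smul_one_left (u : MatrixKernel p) (s : ℂ → ℂ) (B : ℂ → Mat p) (i j : Fin p) :
    sesq u (fun x => s x • 1) B i j = ∑ b, pair (u i b) fun q => s q.1 * B q.2 j b := by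
  simp only [sesq, Matrix.of_apply]
  rw [Finset.sum_eq_single i]
  · simp
  · intro a _ ha
    simp [Matrix.one_apply_ne ha.symm]
  · simp

theorem sesq_smul_one_right (u : MatrixKernel p) (A : ℂ → Mat p) (s : ℂ → ℂ) (i j : Fin p) :
    sesq u A (fun y => s y • 1) i j = ∑ a, pair (u a j) fun q => A q.1 i a * s q.2 := by
  simp only [sesq, Matrix.of_apply]
  refine Finset.sum_congr rfl fun a _ => ?_
  rw [Finset.sum_eq_single j]
  · simp
  · intro b _ hb
    simp [Matrix.one_apply_ne hb.symm]
  · simp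

/-- Cauchy's formula entry by entry. The weight `h` sits inside the pairing, so that both `u` (`h =
1`) and the deformed kernel (`h = e^{t₁}`) are covered. -/
theorem cauchy_sesq_left {u : MatrixKernel p} (hu : IsCompact (supp u)) {r : ℝ}
    (hr : radiusX u < r) {f B : ℂ → Mat p} {h : ℂ → ℂ} (hf : Entire f) (hB : Entire B)
    (hh : Differentiable ℂ h) :
    CircleInt r (fun z => f z * sesq u (fun x => (h x * (z - x)⁻¹) • 1) B) ∧
    matCircle r (fun z => f z * sesq u (fun x => (h x * (z - x)⁻¹) • 1) B) =
      (2 * Real.pi * Complex.I : ℂ) • sesq u (fun x => h x • f x) B := by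
  have key : ∀ i j c b, _ := fun i j c b : Fin p =>
    circleIntegral_mul_pair (isCompact_dsupport hu c b) (ContinuousLinearMap.fst ℝ ℂ ℂ)
      (ContinuousLinearMap.norm_fst_le ℝ ℂ ℂ) ((radiusX_nonneg u).trans_lt hr)
      (fun q hq => norm_fst_lt_of_radiusX_lt hu hr (dsupport_subset_supp u c b hq))
      ((smoothNear_fst hh _).mul (smoothNear_snd (hB j b) _)) (hf i c)
  have e : ∀ i j, (fun z => (f z * sesq u (fun x => (h x * (z - x)⁻¹) • 1) B) i j) = fun z =>
      ∑ c, ∑ b, f z i c * pair (u c b)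
        fun q => (z - ContinuousLinearMap.fst ℝ ℂ ℂ q)⁻¹ * (h q.1 * B q.2 j b) := by
    intro i j
    ext z
    rw [Matrix.mul_apply]
    refine Finset.sum_congr rfl fun c _ => ?_
    rw [sesq_smul_one_left, Finset.mul_sum]
    refine Finset.sum_congr rfl fun b _ => ?_
    congr 2
    ext q
    simp only [ContinuousLinearMap.coe_fst']
    ring
  constructor
  · intro i j
    rw [e]
    exact CircleIntegrable.fun_sum _ fun c _ => CircleIntegrable.fun_sum _ fun b _ =>
      (key i j c b).1
  · ext i j
    simp only [matCircle, Matrix.of_apply, e, Matrix.smul_apply, smul_eq_mul]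
    rw [circleIntegral.integral_fun_sum fun c _ => CircleIntegrable.fun_sum _ fun b _ =>
      (key i j c b).1]
    simp only [sesq, Matrix.of_apply, Finset.mul_sum]
    refine Finset.sum_congr rfl fun c _ => ?_
    rw [circleIntegral.integral_fun_sum fun b _ => (key i j c b).1]
    refine Finset.sum_congr rfl fun b _ => ?_
    rw [(key i j c b).2]
    congr 2
    ext q
    simp only [ContinuousLinearMap.coe_fst', Matrix.smul_apply, smul_eq_mul]
    ring

theorem cauchy_sesq_right {u : MatrixKernel p} (hu : IsCompact (supp u)) {r : ℝ}
    (hr : radiusY u < r) {f A : ℂ → Mat p} {h : ℂ → ℂ} (hf : Entire f) (hA : Entire A)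
    (hh : Differentiable ℂ h) :
    CircleInt r (fun z => sesq u A (fun y => (h y * (z - y)⁻¹) • 1) * f z) ∧
    matCircle r (fun z => sesq u A (fun y => (h y * (z - y)⁻¹) • 1) * f z) =
      (2 * Real.pi * Complex.I : ℂ) • sesq u A (fun y => h y • (f y).transpose) := by
  have key : ∀ i j c a, _ := fun i j c a : Fin p =>
    circleIntegral_mul_pair (isCompact_dsupport hu a c) (ContinuousLinearMap.snd ℝ ℂ ℂ)
      (ContinuousLinearMap.norm_snd_le ℝ ℂ ℂ) ((radiusY_nonneg u).trans_lt hr)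
      (fun q hq => norm_snd_lt_of_radiusY_lt hu hr (dsupport_subset_supp u a c hq))
      ((smoothNear_fst (hA i a) _).mul (smoothNear_snd hh _)) (hf c j)
  have e : ∀ i j, (fun z => (sesq u A (fun y => (h y * (z - y)⁻¹) • 1) * f z) i j) = fun z =>
      ∑ c, ∑ a, f z c j * pair (u a c)
        fun q => (z - ContinuousLinearMap.snd ℝ ℂ ℂ q)⁻¹ * (A q.1 i a * h q.2) := by
    intro i j
    ext z
    rw [Matrix.mul_apply]
    refine Finset.sum_congr rfl fun c _ => ?_
    rw [sesq_smul_one_right, mul_comm, Finset.mul_sum]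
    refine Finset.sum_congr rfl fun b _ => ?_
    congr 2
    ext q
    simp only [ContinuousLinearMap.coe_snd']
    ring
  constructor
  · intro i j
    rw [e]
    exact CircleIntegrable.fun_sum _ fun c _ => CircleIntegrable.fun_sum _ fun a _ =>
      (key i j c a).1
  · ext i j
    simp only [matCircle, Matrix.of_apply, e, Matrix.smul_apply, smul_eq_mul]
    rw [circleIntegral.integral_fun_sum fun c _ => CircleIntegrable.fun_sum _ fun a _ =>
      (key i j c a).1]
    simp only [sesq, Matrix.of_apply, Finset.mul_sum]
    rw [Finset.sum_comm (γ := Fin p)]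
    refine Finset.sum_congr rfl fun c _ => ?_
    rw [circleIntegral.integral_fun_sum fun a _ => (key i j c a).1]
    refine Finset.sum_congr rfl fun a _ => ?_
    rw [(key i j c a).2]
    congr 2
    ext q
    simp only [ContinuousLinearMap.coe_snd', Matrix.smul_apply, smul_eq_mul,
      Matrix.transpose_apply]
    ring

/-- The distributional relation is tested on the entries `A_{ia}(x) B_{jc}(y)`; the matrix
polynomials move across the form because they act by multiplication on test functions. -/
theorem IsGeronimusUvarov.sesq_eq {WC WG : (Mat p)[X]} {u v : MatrixKernel p}
    (hGU : IsGeronimusUvarov WC WG u v) (hu : IsCompact (supp u)) (hv : IsCompact (supp v))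
    {A B : ℂ → Mat p} (hA : Entire A) (hB : Entire B) :
    sesq u (fun x => A x * mval WC x) B = sesq v A (fun y => B y * (mval WG y).transpose) := by
  ext i j
  -- One test function must serve both kernels, hence the agreement near the union of the two
  -- supports.
  have hφ : ∀ a c, ∃ φ : Test, (φ : ℂ × ℂ → ℂ) =ᶠ[𝓝ˢ (supp u ∪ supp v)]
      fun q => A q.1 i a * B q.2 j c := fun a c =>
    (((smoothNear_fst (hA i a) _).mul (smoothNear_snd (hB j c) _)).exists_test (hu.union hv)
      isOpen_univ (subset_univ _)).imp fun _ h => h.1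
  choose φ hφ using hφ
  have hmono : ∀ {s : Set (ℂ × ℂ)} (a c), s ⊆ supp u ∪ supp v →
      ∀ᶠ q in 𝓝ˢ s, φ a c q = A q.1 i a * B q.2 j c := fun a c hs =>
    Filter.Eventually.filter_mono (nhdsSet_mono hs) (hφ a c)
  have hL : ∀ a d c, pair (u d c) (fun q => A q.1 i a * mval WC q.1 a d * B q.2 j c) =
      u d c (mulX (entry WC a d) (φ a c)) := fun a d c => by
    refine pair_eq ?_
    filter_upwards [hmono a c ((dsupport_subset_supp u d c).trans subset_union_left)] with q hq
    change (entry WC a d).eval q.1 * φ a c q = _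
    rw [hq]; simp only [mval, Matrix.of_apply]; ring
  have hR : ∀ a b c, pair (v a b) (fun q => A q.1 i a * (B q.2 j c * mval WG q.2 b c)) =
      v a b (mulY (entry WG b c) (φ a c)) := fun a b c => by
    refine pair_eq ?_
    filter_upwards [hmono a c ((dsupport_subset_supp v a b).trans subset_union_right)] with q hq
    change (entry WG b c).eval q.2 * φ a c q = _
    rw [hq]; simp only [mval, Matrix.of_apply]; ring
  simp only [sesq, Matrix.of_apply, Matrix.mul_apply, Matrix.transpose_apply, Finset.sum_mul,
    Finset.mul_sum]
  have eL : ∀ d c, pair (u d c) (fun q => ∑ a, A q.1 i a * mval WC q.1 a d * B q.2 j c) =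
      ∑ a, u d c (mulX (entry WC a d) (φ a c)) := fun d c => by
    rw [pair_sum (isCompact_dsupport hu d c)]
    · simp only [hL]
    · exact fun a _ => ((smoothNear_fst (hA i a) _).mul
        (smoothNear_fst (entire_mval WC a d) _)).mul (smoothNear_snd (hB j c) _)
  have eR : ∀ a b, pair (v a b) (fun q => ∑ c, A q.1 i a * (B q.2 j c * mval WG q.2 b c)) =
      ∑ c, v a b (mulY (entry WG b c) (φ a c)) := fun a b => by
    rw [pair_sum (isCompact_dsupport hv a b)]
    · simp only [hR]
    · exact fun c _ => (smoothNear_fst (hA i a) _).mul ((smoothNear_snd (hB j c) _).mul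
        (smoothNear_snd (entire_mval WG b c) _))
  simp only [eL, eR]
  calc ∑ d, ∑ c, ∑ a, u d c (mulX (entry WC a d) (φ a c))
      = ∑ a, ∑ c, ∑ d, u d c (mulX (entry WC a d) (φ a c)) := by
        rw [Finset.sum_comm, Finset.sum_congr rfl fun c _ => Finset.sum_comm, Finset.sum_comm]
    _ = ∑ a, ∑ c, ∑ b, v a b (mulY (entry WG b c) (φ a c)) := by
        simp only [hGU.mul_eq]
    _ = _ := Finset.sum_congr rfl fun a _ => Finset.sum_comm

/-! ### Deformations by finitely many times -/

theorem differentiable_timeSeries (s : ℕ →₀ ℂ) : Differentiable ℂ (timeSeries s) := by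
  have : timeSeries s = fun x => ∑ j ∈ s.support, s j * x ^ (j + 1) := by
    ext x
    exact tsum_eq_sum fun j hj => by simp [Finsupp.notMem_support_iff.1 hj]
  rw [this]
  fun_prop

theorem summable_timeSeries (s : ℕ →₀ ℂ) (x : ℂ) : Summable fun j => s j * x ^ (j + 1) :=
  summable_of_ne_finset_zero (s := s.support) fun j hj => by
    simp [Finsupp.notMem_support_iff.1 hj]

theorem hasSum_miwa {x z : ℂ} (h : ‖x‖ < ‖z‖) :
    HasSum (fun j => miwa z j * x ^ (j + 1)) (-Complex.log (1 - z⁻¹ * x)) := by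
  have hz : 0 < ‖z‖ := (norm_nonneg x).trans_lt h
  have h1 : ‖z⁻¹ * x‖ < 1 := by
    rw [norm_mul, norm_inv, inv_mul_lt_iff₀ hz, mul_one]; exact h
  have h2 := (hasSum_nat_add_iff' 1).2 (Complex.hasSum_taylorSeries_neg_log h1)
  simp only [Finset.range_one, Finset.sum_singleton, Nat.cast_zero, div_zero, sub_zero] at h2
  refine (?_ : _ = fun j => miwa z j * x ^ (j + 1)) ▸ h2
  ext j
  simp only [miwa]
  push_cast
  rw [mul_pow, inv_pow, one_div, mul_inv]
  ring

theorem one_sub_ne_zero_of_norm_lt {x z : ℂ} (h : ‖x‖ < ‖z‖) : 1 - z⁻¹ * x ≠ 0 := by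
  have hz : 0 < ‖z‖ := (norm_nonneg x).trans_lt h
  intro h0
  have h1 : ‖z⁻¹ * x‖ < 1 := by
    rw [norm_mul, norm_inv, inv_mul_lt_iff₀ hz, mul_one]; exact h
  rw [← sub_eq_zero.1 h0] at h1
  simp at h1

/-- The Miwa series sums to `-log (1 - x / z)` for `‖x‖ < ‖z‖`, so its exponential is `(1 - x /
z)⁻¹`. -/
theorem exp_timeSeries_sub_miwa (s : ℕ →₀ ℂ) {x z : ℂ} (h : ‖x‖ < ‖z‖) :
    Complex.exp (timeSeries (s - miwa z) x) =
      Complex.exp (timeSeries s x) * (1 - z⁻¹ * x) := by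
  have := ((summable_timeSeries s x).hasSum.sub (hasSum_miwa h)).tsum_eq
  simp only [← sub_mul] at this
  rw [timeSeries]
  simp only [Pi.sub_apply]
  rw [this, sub_neg_eq_add, Complex.exp_add, Complex.exp_log (one_sub_ne_zero_of_norm_lt h)]
  rfl

theorem exp_timeSeries_add_miwa (s : ℕ →₀ ℂ) {x z : ℂ} (h : ‖x‖ < ‖z‖) :
    Complex.exp (timeSeries (s + miwa z) x) * (1 - z⁻¹ * x) =
      Complex.exp (timeSeries s x) := by
  have := ((summable_timeSeries s x).hasSum.add (hasSum_miwa h)).tsum_eq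
  simp only [← add_mul] at this
  rw [timeSeries]
  simp only [Pi.add_apply]
  rw [this, Complex.exp_add, Complex.exp_neg, Complex.exp_log (one_sub_ne_zero_of_norm_lt h),
    inv_mul_cancel_right₀ (one_sub_ne_zero_of_norm_lt h)]
  rfl

theorem differentiable_expX (s₁ : ℕ →₀ ℂ) (s₂ : ℕ → ℂ) :
    Differentiable ℂ (expX ((s₁ : ℕ → ℂ), s₂)) := (differentiable_timeSeries s₁).cexp

theorem differentiable_expY (s₁ : ℕ → ℂ) (s₂ : ℕ →₀ ℂ) :
    Differentiable ℂ (expY (s₁, (s₂ : ℕ → ℂ))) := (differentiable_timeSeries s₂).neg.cexp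

/-! ### Moments -/

theorem gram_apply (u : MatrixKernel p) (t : Times) (k l : ℕ) (i j : Fin p) :
    gram u t k l i j =
      pair (u i j) fun q => (expX t q.1 * q.1 ^ k) * (expY t q.2 * q.2 ^ l) := by
  rw [gram, sesqT]
  simp only [smul_smul]
  rw [sesq_smul_one_left, Finset.sum_eq_single j]
  · simp
  · intro b _ hb
    simp [Matrix.one_apply_ne hb.symm]
  · simp

theorem smoothNear_weight {K : Set (ℂ × ℂ)} {t : Times} (hX : SmoothNear K fun q => expX t q.1)
    (hY : SmoothNear K fun q => expY t q.2) (k l : ℕ) :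
    SmoothNear K fun q => (expX t q.1 * q.1 ^ k) * (expY t q.2 * q.2 ^ l) :=
  (hX.mul (smoothNear_fst (differentiable_pow k) K)).mul
    (hY.mul (smoothNear_snd (differentiable_pow l) K))

theorem gram_eq_sub_shift_fst {u : MatrixKernel p} (hu : IsCompact (supp u)) {s t : Times} {c : ℂ}
    (hX : SmoothNear (supp u) fun q => expX t q.1) (hY : SmoothNear (supp u) fun q => expY t q.2)
    (h₁ : ∀ᶠ q in 𝓝ˢ (supp u), expX s q.1 = expX t q.1 * (1 - c * q.1))
    (h₂ : ∀ᶠ q in 𝓝ˢ (supp u), expY s q.2 = expY t q.2) (k l : ℕ) :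
    gram u s k l = gram u t k l - c • gram u t (k + 1) l := by
  ext i j
  have hsub := dsupport_subset_supp u i j
  have hc := isCompact_dsupport hu i j
  have hw := fun k => (smoothNear_weight hX hY k l).mono hsub
  rw [Matrix.sub_apply, Matrix.smul_apply, gram_apply, gram_apply, gram_apply, smul_eq_mul,
    sub_eq_add_neg, ← neg_mul, ← pair_const_mul hc _ (hw _),
    ← pair_add hc (hw _) ((SmoothNear.const _).mul (hw _))]
  refine pair_congr (Filter.Eventually.filter_mono (nhdsSet_mono hsub) ?_)
  filter_upwards [h₁, h₂] with q h1 h2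
  rw [h1, h2]; ring

theorem gram_eq_sub_shift_snd {u : MatrixKernel p} (hu : IsCompact (supp u)) {s t : Times} {c : ℂ}
    (hX : SmoothNear (supp u) fun q => expX t q.1) (hY : SmoothNear (supp u) fun q => expY t q.2)
    (h₁ : ∀ᶠ q in 𝓝ˢ (supp u), expX s q.1 = expX t q.1)
    (h₂ : ∀ᶠ q in 𝓝ˢ (supp u), expY s q.2 = expY t q.2 * (1 - c * q.2)) (k l : ℕ) :
    gram u s k l = gram u t k l - c • gram u t k (l + 1) := by
  ext i j
  have hsub := dsupport_subset_supp u i j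
  have hc := isCompact_dsupport hu i j
  have hw := fun l => (smoothNear_weight hX hY k l).mono hsub
  rw [Matrix.sub_apply, Matrix.smul_apply, gram_apply, gram_apply, gram_apply, smul_eq_mul,
    sub_eq_add_neg, ← neg_mul, ← pair_const_mul hc _ (hw _),
    ← pair_add hc (hw _) ((SmoothNear.const _).mul (hw _))]
  refine pair_congr (Filter.Eventually.filter_mono (nhdsSet_mono hsub) ?_)
  filter_upwards [h₁, h₂] with q h1 h2
  rw [h1, h2]; ring

/-- For second kind functions: once the Cauchy kernel has been absorbed into the weight of shifted
times `t`, only the zeroth power of `x` is left, hence the row `gram u t 0 j`. -/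
theorem sesq_scalar_left_eq_sum_gram {u : MatrixKernel p} (hu : IsCompact (supp u)) {t : Times}
    (hX : SmoothNear (supp u) fun q => expX t q.1) (hY : SmoothNear (supp u) fun q => expY t q.2)
    {s : ℂ → ℂ} {c : ℂ} {B : ℂ → Mat p} {n : ℕ} {S : ℕ → Mat p}
    (hs : ∀ᶠ q in 𝓝ˢ (supp u), s q.1 = c * expX t q.1)
    (hB : ∀ᶠ q in 𝓝ˢ (supp u), B q.2 = expY t q.2 • ∑ j ∈ Finset.range n, q.2 ^ j • S j) :
    sesq u (fun x => s x • 1) B = c • ∑ j ∈ Finset.range n, gram u t 0 j * (S j).transpose := by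
  ext i j
  rw [sesq_smul_one_left, Matrix.smul_apply, Matrix.sum_apply]
  simp only [Matrix.mul_apply]
  rw [Finset.sum_comm, Finset.smul_sum]
  refine Finset.sum_congr rfl fun b _ => ?_
  have hsub := dsupport_subset_supp u i b
  have hc := isCompact_dsupport hu i b
  have hw := fun m => (smoothNear_weight hX hY 0 m).mono hsub
  have e : pair (u i b) (fun q => s q.1 * B q.2 j b) = pair (u i b) fun q =>
      ∑ m ∈ Finset.range n, (c * S m j b) *
        ((expX t q.1 * q.1 ^ 0) * (expY t q.2 * q.2 ^ m)) := by
    refine pair_congr (Filter.Eventually.filter_mono (nhdsSet_mono hsub) ?_)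
    filter_upwards [hs, hB] with q h1 h2
    rw [h1, h2, Matrix.smul_apply, Matrix.sum_apply, smul_eq_mul, Finset.mul_sum, Finset.mul_sum]
    refine Finset.sum_congr rfl fun m _ => ?_
    rw [Matrix.smul_apply, smul_eq_mul]; ring
  rw [e, pair_sum hc _ fun m _ => (SmoothNear.const _).mul (hw m), smul_eq_mul, Finset.mul_sum]
  refine Finset.sum_congr rfl fun m _ => ?_
  rw [pair_const_mul hc _ (hw m), gram_apply, Matrix.transpose_apply]
  ring

theorem sesq_scalar_right_eq_sum_gram {u : MatrixKernel p} (hu : IsCompact (supp u)) {t : Times}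
    (hX : SmoothNear (supp u) fun q => expX t q.1) (hY : SmoothNear (supp u) fun q => expY t q.2)
    {s : ℂ → ℂ} {c : ℂ} {A : ℂ → Mat p} {n : ℕ} {S : ℕ → Mat p}
    (hs : ∀ᶠ q in 𝓝ˢ (supp u), s q.2 = c * expY t q.2)
    (hA : ∀ᶠ q in 𝓝ˢ (supp u), A q.1 = expX t q.1 • ∑ j ∈ Finset.range n, q.1 ^ j • S j) :
    sesq u A (fun y => s y • 1) = c • ∑ j ∈ Finset.range n, S j * gram u t j 0 := by
  ext i j
  rw [sesq_smul_one_right, Matrix.smul_apply, Matrix.sum_apply]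
  simp only [Matrix.mul_apply]
  rw [Finset.sum_comm, Finset.smul_sum]
  refine Finset.sum_congr rfl fun a _ => ?_
  have hsub := dsupport_subset_supp u a j
  have hc := isCompact_dsupport hu a j
  have hw := fun m => (smoothNear_weight hX hY m 0).mono hsub
  have e : pair (u a j) (fun q => A q.1 i a * s q.2) = pair (u a j) fun q =>
      ∑ m ∈ Finset.range n, (c * S m i a) *
        ((expX t q.1 * q.1 ^ m) * (expY t q.2 * q.2 ^ 0)) := by
    refine pair_congr (Filter.Eventually.filter_mono (nhdsSet_mono hsub) ?_)
    filter_upwards [hs, hA] with q h1 h2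
    rw [h1, h2, Matrix.smul_apply, Matrix.sum_apply, smul_eq_mul, Finset.mul_sum, Finset.sum_mul]
    refine Finset.sum_congr rfl fun m _ => ?_
    rw [Matrix.smul_apply, smul_eq_mul]; ring
  rw [e, pair_sum hc _ fun m _ => (SmoothNear.const _).mul (hw m), smul_eq_mul, Finset.mul_sum]
  refine Finset.sum_congr rfl fun m _ => ?_
  rw [pair_const_mul hc _ (hw m), gram_apply]
  ring

/-! ### Miwa shifts -/

section Miwa

variable {u : MatrixKernel p} (hu : IsCompact (supp u)) {t : Times} {s₁ s₂ : ℕ →₀ ℂ}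
  (ht : t = ((s₁ : ℕ → ℂ), (s₂ : ℕ → ℂ))) {r : ℝ} {z : ℂ}

theorem sub_inv_eq {x z : ℂ} (h : ‖x‖ < ‖z‖) : (z - x)⁻¹ = z⁻¹ * (1 - z⁻¹ * x)⁻¹ := by
  have hz : z ≠ 0 := norm_pos_iff.1 ((norm_nonneg x).trans_lt h)
  rw [← mul_inv, mul_sub, mul_one, mul_inv_cancel_left₀ hz]

theorem smoothNear_mul_inv_fst (hu : IsCompact (supp u)) (hr : radiusX u < r) (hz : ‖z‖ = r)
    {f : ℂ → ℂ} (hf : Differentiable ℂ f) :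
    SmoothNear (supp u) fun q => f q.1 * (1 - z⁻¹ * q.1)⁻¹ := by
  refine (smoothNear_fst hf _).mul ?_
  filter_upwards [eventually_norm_fst_lt hu hr] with q hq
  exact ContDiffAt.inv (by fun_prop) (one_sub_ne_zero_of_norm_lt (hz ▸ hq))

theorem smoothNear_mul_inv_snd (hu : IsCompact (supp u)) (hr : radiusY u < r) (hz : ‖z‖ = r)
    {f : ℂ → ℂ} (hf : Differentiable ℂ f) :
    SmoothNear (supp u) fun q => f q.2 * (1 - z⁻¹ * q.2)⁻¹ := by
  refine (smoothNear_snd hf _).mul ?_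
  filter_upwards [eventually_norm_snd_lt hu hr] with q hq
  exact ContDiffAt.inv (by fun_prop) (one_sub_ne_zero_of_norm_lt (hz ▸ hq))

theorem expY_sub_miwa₁ (t : Times) (z : ℂ) : expY (t - miwa₁ z) = expY t := by
  ext y; simp [expY, miwa₁]

theorem expY_add_miwa₁ (t : Times) (z : ℂ) : expY (t + miwa₁ z) = expY t := by
  ext y; simp [expY, miwa₁]

theorem expX_sub_miwa₂ (t : Times) (z : ℂ) : expX (t - miwa₂ z) = expX t := by
  ext y; simp [expX, miwa₂]

theorem expX_add_miwa₂ (t : Times) (z : ℂ) : expX (t + miwa₂ z) = expX t := by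
  ext y; simp [expX, miwa₂]

include ht

theorem expX_sub_miwa₁ {x : ℂ} (h : ‖x‖ < ‖z‖) :
    expX (t - miwa₁ z) x =
      expX t x * (1 - z⁻¹ * x) :=
  ht ▸ exp_timeSeries_sub_miwa s₁ h

theorem expX_add_miwa₁ {x : ℂ} (h : ‖x‖ < ‖z‖) :
    expX (t + miwa₁ z) x * (1 - z⁻¹ * x) =
      expX t x :=
  ht ▸ exp_timeSeries_add_miwa s₁ h

theorem expY_add_miwa₂ {y : ℂ} (h : ‖y‖ < ‖z‖) :
    expY (t + miwa₂ z) y =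
      expY t y * (1 - z⁻¹ * y) := by
  subst ht
  change Complex.exp (-timeSeries (s₂ + miwa z) y) = Complex.exp (-timeSeries s₂ y) * _
  rw [Complex.exp_neg, Complex.exp_neg, ← exp_timeSeries_add_miwa s₂ h, mul_inv,
    inv_mul_cancel_right₀ (one_sub_ne_zero_of_norm_lt h)]

theorem expY_sub_miwa₂ {y : ℂ} (h : ‖y‖ < ‖z‖) :
    expY (t - miwa₂ z) y * (1 - z⁻¹ * y) =
      expY t y := by
  subst ht
  change Complex.exp (-timeSeries (s₂ - miwa z) y) * _ = Complex.exp (-timeSeries s₂ y)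
  rw [Complex.exp_neg, Complex.exp_neg, exp_timeSeries_sub_miwa s₂ h, mul_inv,
    inv_mul_cancel_right₀ (one_sub_ne_zero_of_norm_lt h)]

include hu

theorem P₁_eq_tau₁ (hr : radiusX u < r) (hz : ‖z‖ = r)
    (h : Quasidefinite (gram u t)) (h' : Quasidefinite (gram u (t - miwa₁ z)))
    (n : ℕ) :
    P₁ u t n z = z ^ n • tau₁ u n (t - miwa₁ z) t := by
  have hz0 : z ≠ 0 := norm_pos_iff.1 (hz ▸ (radiusX_nonneg u).trans_lt hr)
  refine IsGaussBorel.sum_pow_smul_S₁ h h.gaussBorel h'.gaussBorel hz0 ?_ n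
  refine gram_eq_sub_shift_fst hu (smoothNear_fst (ht ▸ differentiable_expX s₁ s₂) _)
    (smoothNear_snd (ht ▸ differentiable_expY s₁ s₂) _) ?_ (by simp [expY_sub_miwa₁])
  filter_upwards [eventually_norm_fst_lt hu hr] with q hq
  exact expX_sub_miwa₁ ht (hz ▸ hq)

/-- Here the shifted times give the original kernel of the connection formula and `t` the one
multiplied by `1 - x / z`. The Cauchy kernel satisfies `e^{t₁(x)} / (z - x) = z⁻¹ e^{(t +
[z]₁)₁(x)}`. -/
theorem tau₁_mul_C₂ (hr : radiusX u < r) (hz : ‖z‖ = r)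
    (h : Quasidefinite (gram u t)) (h' : Quasidefinite (gram u (t + miwa₁ z)))
    (n : ℕ) :
    tau₁ u (n + 1) t (t + miwa₁ z) * (C₂ u t n z).transpose =
      z⁻¹ ^ (n + 1) • quasitau u t n := by
  have hev : ∀ᶠ q in 𝓝ˢ (supp u), ‖q.1‖ < ‖z‖ := hz ▸ eventually_norm_fst_lt hu hr
  have hX : SmoothNear (supp u) fun q => expX (t + miwa₁ z) q.1 := by
    refine (smoothNear_mul_inv_fst hu hr hz (ht ▸ differentiable_expX s₁ s₂)).congr ?_
    filter_upwards [hev] with q hq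
    rw [← expX_add_miwa₁ ht hq, mul_inv_cancel_right₀ (one_sub_ne_zero_of_norm_lt hq)]
  have hY : SmoothNear (supp u) fun q => expY (t + miwa₁ z) q.2 := by
    rw [expY_add_miwa₁]
    exact smoothNear_snd (ht ▸ differentiable_expY s₁ s₂) _
  have hsh : ∀ k l, gram u t k l = gram u (t + miwa₁ z) k l -
      z⁻¹ • gram u (t + miwa₁ z) (k + 1) l := by
    refine gram_eq_sub_shift_fst hu hX hY ?_ (by simp [expY_add_miwa₁])
    filter_upwards [hev] with q hq
    exact (expX_add_miwa₁ ht hq).symm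
  have hC : (C₂ u t n z).transpose = z⁻¹ • ∑ j ∈ Finset.range (n + 1),
      gram u (t + miwa₁ z) 0 j * ((gaussBorel (gram u t)).S₂ n j).transpose := by
    rw [C₂, Matrix.transpose_transpose, sesqT]
    simp only [smul_smul]
    refine sesq_scalar_left_eq_sum_gram hu hX hY ?_ ?_
    · filter_upwards [hev] with q hq
      rw [← expX_add_miwa₁ ht hq, sub_inv_eq hq, mul_assoc, mul_left_comm _ z⁻¹,
        mul_inv_cancel₀ (one_sub_ne_zero_of_norm_lt hq), mul_one, mul_comm]
    · exact Eventually.of_forall fun q => by rw [expY_add_miwa₁, P₂]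
  rw [hC, mul_smul_comm, tau₁]
  have := IsGaussBorel.descProd_mul_sum h' h'.gaussBorel h.gaussBorel hsh n
  simp only [quasitau]
  rw [this, smul_smul, pow_succ']

/-- As the weight is `e^{-t₂(y)}`, it is the shift `t + [z]₂` that multiplies the kernel by `1 - y /
z`, opposite to the first variable. -/
theorem P₂_eq_tau₂ (hr : radiusY u < r) (hz : ‖z‖ = r)
    (h : Quasidefinite (gram u t)) (h' : Quasidefinite (gram u (t + miwa₂ z)))
    (n : ℕ) :
    (P₂ u t n z).transpose = z ^ n • (tau₂ u n (t + miwa₂ z) t)⁻¹ := by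
  have hz0 : z ≠ 0 := norm_pos_iff.1 (hz ▸ (radiusY_nonneg u).trans_lt hr)
  refine IsGaussBorel.transpose_sum_pow_smul_S₂ h h.gaussBorel h' h'.gaussBorel hz0 ?_ n
  refine gram_eq_sub_shift_snd hu (smoothNear_fst (ht ▸ differentiable_expX s₁ s₂) _)
    (smoothNear_snd (ht ▸ differentiable_expY s₁ s₂) _) (by simp [expX_add_miwa₂]) ?_
  filter_upwards [eventually_norm_snd_lt hu hr] with q hq
  exact expY_add_miwa₂ ht (hz ▸ hq)

theorem C₁_eq_tau₂ (hr : radiusY u < r) (hz : ‖z‖ = r)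
    (h : Quasidefinite (gram u t)) (h' : Quasidefinite (gram u (t - miwa₂ z)))
    (n : ℕ) :
    C₁ u t n z = z⁻¹ ^ (n + 1) •
      (quasitau u t n * tau₂ u (n + 1) t (t - miwa₂ z)) := by
  have hev : ∀ᶠ q in 𝓝ˢ (supp u), ‖q.2‖ < ‖z‖ := hz ▸ eventually_norm_snd_lt hu hr
  have hY : SmoothNear (supp u) fun q => expY (t - miwa₂ z) q.2 := by
    refine (smoothNear_mul_inv_snd hu hr hz (ht ▸ differentiable_expY s₁ s₂)).congr ?_
    filter_upwards [hev] with q hq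
    rw [← expY_sub_miwa₂ ht hq, mul_inv_cancel_right₀ (one_sub_ne_zero_of_norm_lt hq)]
  have hX : SmoothNear (supp u) fun q => expX (t - miwa₂ z) q.1 := by
    rw [expX_sub_miwa₂]
    exact smoothNear_fst (ht ▸ differentiable_expX s₁ s₂) _
  have hsh : ∀ k l, gram u t k l = gram u (t - miwa₂ z) k l -
      z⁻¹ • gram u (t - miwa₂ z) k (l + 1) := by
    refine gram_eq_sub_shift_snd hu hX hY (by simp [expX_sub_miwa₂]) ?_
    filter_upwards [hev] with q hq
    exact (expY_sub_miwa₂ ht hq).symm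
  have hC : C₁ u t n z = z⁻¹ • ∑ j ∈ Finset.range (n + 1),
      (gaussBorel (gram u t)).S₁ n j * gram u (t - miwa₂ z) j 0 := by
    rw [C₁, sesqT]
    simp only [smul_smul]
    refine sesq_scalar_right_eq_sum_gram hu hX hY ?_ ?_
    · filter_upwards [hev] with q hq
      rw [← expY_sub_miwa₂ ht hq, sub_inv_eq hq, mul_assoc, mul_left_comm _ z⁻¹,
        mul_inv_cancel₀ (one_sub_ne_zero_of_norm_lt hq), mul_one, mul_comm]
    · exact Eventually.of_forall fun q => by rw [expX_sub_miwa₂, P₁]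
  rw [hC, IsGaussBorel.sum_S₁_mul h' h'.gaussBorel h h.gaussBorel hsh n, smul_smul, pow_succ',
    tau₂]
  rfl

end Miwa

end GUBilinear

/-! ### The bilinear identities -/

open GUBilinear
theorem mainTheorem11 (p : ℕ) (WC WG : (Mat p)[X]) (hWC : WC.Monic)
    (u v : MatrixKernel p) (hu : IsCompact (supp u)) (hv : IsCompact (supp v))
    (hGU : IsGeronimusUvarov WC WG u v)
    (t₁ t₂ t₁' t₂' : ℕ →₀ ℂ) (t t' : Times) (ht : t = (⇑t₁, ⇑t₂)) (ht' : t' = (⇑t₁', ⇑t₂'))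
    (hqu : Quasidefinite (gram u t)) (hqv : Quasidefinite (gram v t'))
    (r₁ r₂ : ℝ) (hr₁ : radiusX u < r₁) (hr₂ : radiusY v < r₂) (k l : ℕ) :
    -- Baker functions
    CircleEq
      r₁ (fun z => Ψ₁ v t' k z * mval WC z * (Ψ₁star u t l z).transpose)
      r₂ (fun z => Ψ₂ v t' k z * mval WG z * (Ψ₂star u t l z).transpose) ∧
    -- biorthogonal polynomials and second kind functions
    CircleEq
      r₁ (fun z => Complex.exp (timeSeries t'.1 z - timeSeries t.1 z) •
        (P₁ v t' k z * mval WC z * (C₂ u t l z).transpose))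
      r₂ (fun z => Complex.exp (timeSeries t'.2 z - timeSeries t.2 z) •
        (C₁ v t' k z * mval WG z * (P₂ u t l z).transpose)) ∧
    -- τ-ratio matrices; the Miwa shifts are made inside the sesquilinear forms of both kernels
    (radiusX v < r₁ → radiusY u < r₂ →
      (∀ z : ℂ, ‖z‖ = r₁ → Quasidefinite (gram v (t' - miwa₁ z)) ∧
        Quasidefinite (gram u (t + miwa₁ z))) →
      (∀ z : ℂ, ‖z‖ = r₂ → Quasidefinite (gram v (t' - miwa₂ z)) ∧
        Quasidefinite (gram u (t + miwa₂ z))) →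
      CircleInt r₁ (fun z => (Complex.exp (timeSeries t'.1 z - timeSeries t.1 z) *
        z ^ ((k : ℤ) - l - 1)) •
          (tau₁ v k (t' - miwa₁ z) t' * mval WC z * (tau₁ u (l + 1) t (t + miwa₁ z))⁻¹)) ∧
      CircleInt r₂ (fun z => (z ^ ((l : ℤ) - k - 1) *
        Complex.exp (timeSeries t'.2 z - timeSeries t.2 z)) •
          (tau₂ v (k + 1) t' (t' - miwa₂ z) * mval WG z * (tau₂ u l (t + miwa₂ z) t)⁻¹)) ∧
      matCircle r₁ (fun z => (Complex.exp (timeSeries t'.1 z - timeSeries t.1 z) *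
        z ^ ((k : ℤ) - l - 1)) •
          (tau₁ v k (t' - miwa₁ z) t' * mval WC z * (tau₁ u (l + 1) t (t + miwa₁ z))⁻¹)) *
        quasitau u t l =
      quasitau v t' k *
        matCircle r₂ (fun z => (z ^ ((l : ℤ) - k - 1) *
          Complex.exp (timeSeries t'.2 z - timeSeries t.2 z)) •
            (tau₂ v (k + 1) t' (t' - miwa₂ z) * mval WG z *
              (tau₂ u l (t + miwa₂ z) t)⁻¹))) := by
  have hr₁0 : 0 < r₁ := (radiusX_nonneg u).trans_lt hr₁
  have hr₂0 : 0 < r₂ := (radiusY_nonneg v).trans_lt hr₂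
  have hX : Differentiable ℂ (expX t) := ht ▸ differentiable_expX t₁ t₂
  have hX' : Differentiable ℂ (expX t') := ht' ▸ differentiable_expX t₁' t₂'
  have hY : Differentiable ℂ (expY t) := ht ▸ differentiable_expY t₁ t₂
  have hY' : Differentiable ℂ (expY t') := ht' ▸ differentiable_expY t₁' t₂'
  have hP := entire_P₁ v t' k
  have hQ := entire_P₂ u t l
  have hd₁ : Differentiable ℂ fun z => Complex.exp (timeSeries t'.1 z - timeSeries t.1 z) := by
    rw [ht, ht']
    exact ((differentiable_timeSeries t₁').fun_sub (differentiable_timeSeries t₁)).cexp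
  have hd₂ : Differentiable ℂ fun z => Complex.exp (timeSeries t'.2 z - timeSeries t.2 z) := by
    rw [ht, ht']
    exact ((differentiable_timeSeries t₂').fun_sub (differentiable_timeSeries t₂)).cexp
  -- The common value of both contour integrals, up to `2πi` and, in the Baker form, `(H_l)⁻¹`.
  have hGUs := hGU.sesq_eq hu hv (hP.smul hX') (hQ.smul hY)
  have baker : CircleEq
      r₁ (fun z => Ψ₁ v t' k z * mval WC z * (Ψ₁star u t l z).transpose)
      r₂ (fun z => Ψ₂ v t' k z * mval WG z * (Ψ₂star u t l z).transpose) := by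
    obtain ⟨i₁, e₁⟩ := cauchy_sesq_left hu hr₁ (h := fun _ => 1)
      (((hP.smul hX').mul (entire_mval WC))) (hQ.smul hY) (differentiable_const 1)
    obtain ⟨i₂, e₂⟩ := cauchy_sesq_right hv hr₂ (h := fun _ => 1)
      ((entire_mval WG).mul (hQ.smul hY).transpose) (hP.smul hX') (differentiable_const 1)
    simp only [one_mul, one_smul, Matrix.transpose_mul, Matrix.transpose_transpose] at i₁ e₁ i₂ e₂
    have f₁ : (fun z => Ψ₁ v t' k z * mval WC z * (Ψ₁star u t l z).transpose) =
        fun z => (expX t' z • P₁ v t' k z * mval WC z * sesq u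
          (fun x => (z - x)⁻¹ • 1) fun y => expY t y • P₂ u t l y) *
          (quasitau u t l)⁻¹ := by
      ext1 z
      rw [Ψ₁, Ψ₁star, Matrix.transpose_transpose, mul_assoc, mul_assoc, mul_assoc]
    have f₂ : (fun z => Ψ₂ v t' k z * mval WG z * (Ψ₂star u t l z).transpose) =
        fun z => (sesq v (fun x => expX t' x • P₁ v t' k x)
          (fun y => (z - y)⁻¹ • 1) * (mval WG z *
            (expY t z • P₂ u t l z).transpose)) * (quasitau u t l)⁻¹ := by
      ext1 z
      rw [Ψ₂, Ψ₂star, Matrix.transpose_smul, Matrix.transpose_mul, Matrix.transpose_transpose,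
        Matrix.transpose_smul]
      simp only [mul_assoc, smul_mul_assoc]
    rw [f₁, f₂]
    exact ⟨i₁.mul_const _, i₂.mul_const _, by
      rw [matCircle_mul_const i₁, matCircle_mul_const i₂, e₁, e₂, hGUs]⟩
  have second : CircleEq
      r₁ (fun z => Complex.exp (timeSeries t'.1 z - timeSeries t.1 z) •
        (P₁ v t' k z * mval WC z * (C₂ u t l z).transpose))
      r₂ (fun z => Complex.exp (timeSeries t'.2 z - timeSeries t.2 z) •
        (C₁ v t' k z * mval WG z * (P₂ u t l z).transpose)) := by
    -- The weight `e^{t₁}` of `u^t` now sits inside the pairing, and the factor `e^{t₁' - t₁}`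
    -- outside turns it into `e^{t₁'}` after Cauchy's formula. The same happens with `e^{-t₂'}` and
    -- `e^{t₂' - t₂}` on the other side.
    obtain ⟨i₁, e₁⟩ := cauchy_sesq_left hu hr₁ ((hP.mul (entire_mval WC)).smul hd₁) (hQ.smul hY) hX
    obtain ⟨i₂, e₂⟩ := cauchy_sesq_right hv hr₂
      (((entire_mval WG).mul hQ.transpose).smul hd₂) (hP.smul hX') hY'
    have f₁ : (fun z => Complex.exp (timeSeries t'.1 z - timeSeries t.1 z) •
        (P₁ v t' k z * mval WC z * (C₂ u t l z).transpose)) = fun z =>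
        Complex.exp (timeSeries t'.1 z - timeSeries t.1 z) • (P₁ v t' k z * mval WC z) *
          sesq u (fun x => (expX t x * (z - x)⁻¹) • 1)
            fun y => expY t y • P₂ u t l y := by
      ext1 z
      rw [C₂, Matrix.transpose_transpose, sesqT, smul_mul_assoc]
      simp only [smul_smul]
    have f₂ : (fun z => Complex.exp (timeSeries t'.2 z - timeSeries t.2 z) •
        (C₁ v t' k z * mval WG z * (P₂ u t l z).transpose)) = fun z =>
        sesq v (fun x => expX t' x • P₁ v t' k x)
          (fun y => (expY t' y * (z - y)⁻¹) • 1) *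
          Complex.exp (timeSeries t'.2 z - timeSeries t.2 z) •
            (mval WG z * (P₂ u t l z).transpose) := by
      ext1 z
      rw [C₁, sesqT, mul_smul_comm, mul_assoc]
      simp only [smul_smul]
    have g₁ : (fun x => expX t x • Complex.exp (timeSeries t'.1 x - timeSeries t.1 x) •
        (P₁ v t' k x * mval WC x)) =
        fun x => expX t' x • P₁ v t' k x * mval WC x := by
      ext1 x
      rw [smul_smul, expX, expX, ← Complex.exp_add, smul_mul_assoc]
      congr 2
      simp
    have g₂ : (fun y => expY t' y • (Complex.exp (timeSeries t'.2 y - timeSeries t.2 y) •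
        (mval WG y * (P₂ u t l y).transpose)).transpose) =
        fun y => expY t y • P₂ u t l y * (mval WG y).transpose := by
      ext1 y
      rw [Matrix.transpose_smul, smul_smul, expY, expY, ← Complex.exp_add, smul_mul_assoc,
        Matrix.transpose_mul, Matrix.transpose_transpose]
      congr 2
      ring
    rw [f₁, f₂]
    exact ⟨i₁, i₂, by rw [e₁, e₂, g₁, g₂, hGUs]⟩
  refine ⟨baker, second, fun hr₁' hr₂' hq₁ hq₂ => ?_⟩
  have hHu := hqu.gaussBorel.isUnit_det hqu l
  have hHv := hqv.gaussBorel.isUnit_det hqv k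
  -- Pointwise on the circle, `z ^ k` from `P̂_k` and `z ^ (-l-1)` from the second kind function
  -- combine to `z ^ (k-l-1)`. The right factor `(H_l)⁻¹` cancels the `H_l` produced by the latter.
  have f₁ : ∀ z : ℂ, ‖z‖ = r₁ →
      (Complex.exp (timeSeries t'.1 z - timeSeries t.1 z) •
        (P₁ v t' k z * mval WC z * (C₂ u t l z).transpose)) *
          (quasitau u t l)⁻¹ =
      (Complex.exp (timeSeries t'.1 z - timeSeries t.1 z) * z ^ ((k : ℤ) - l - 1)) •
        (tau₁ v k (t' - miwa₁ z) t' * mval WC z *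
          (tau₁ u (l + 1) t (t + miwa₁ z))⁻¹) := by
    intro z hz
    have hz0 : z ≠ 0 := norm_pos_iff.1 (hz ▸ hr₁0)
    have hu' := (hq₁ z hz).2
    have hτ : IsUnit (tau₁ u (l + 1) t (t + miwa₁ z)).det :=
      isUnit_det_descProd (fun m => by
        rw [Matrix.det_mul]
        exact (hqu.gaussBorel.isUnit_det hqu m).mul
          (Matrix.isUnit_nonsing_inv_det _ (hu'.gaussBorel.isUnit_det hu' m))) _
    have hC := congrArg (fun M => (tau₁ u (l + 1) t (t + miwa₁ z))⁻¹ *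
      (M * (quasitau u t l)⁻¹)) (tau₁_mul_C₂ hu ht hr₁ hz hqu hu' l)
    simp only [smul_mul_assoc, quasitau, Matrix.mul_nonsing_inv _ hHu, mul_smul_comm, mul_one] at hC
    rw [mul_assoc, Matrix.nonsing_inv_mul_cancel_left _ _ hτ] at hC
    rw [inv_pow, eq_inv_smul_iff₀ (pow_ne_zero _ hz0)] at hC
    rw [← hC, P₁_eq_tau₁ hv ht' hr₁' hz hqv (hq₁ z hz).1 k]
    simp only [smul_mul_assoc, mul_smul_comm, smul_smul, mul_assoc, quasitau]
    congr 2
    rw [← zpow_natCast, ← zpow_natCast, ← zpow_add₀ hz0]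
    congr 1
    push_cast; ring
  have f₂ : ∀ z : ℂ, ‖z‖ = r₂ →
      (quasitau v t' k)⁻¹ * (Complex.exp (timeSeries t'.2 z - timeSeries t.2 z) •
        (C₁ v t' k z * mval WG z * (P₂ u t l z).transpose)) =
      (z ^ ((l : ℤ) - k - 1) * Complex.exp (timeSeries t'.2 z - timeSeries t.2 z)) •
        (tau₂ v (k + 1) t' (t' - miwa₂ z) * mval WG z *
          (tau₂ u l (t + miwa₂ z) t)⁻¹) := by
    intro z hz
    have hz0 : z ≠ 0 := norm_pos_iff.1 (hz ▸ hr₂0)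
    rw [P₂_eq_tau₂ hu ht hr₂' hz hqu (hq₂ z hz).2 l,
      C₁_eq_tau₂ hv ht' hr₂ hz hqv (hq₂ z hz).1 k]
    simp only [smul_mul_assoc, mul_smul_comm, smul_smul, mul_assoc, quasitau]
    rw [Matrix.nonsing_inv_mul_cancel_left _ _ hHv, mul_comm]
    congr 2
    rw [inv_pow, ← zpow_natCast, ← zpow_natCast, ← zpow_neg, ← zpow_add₀ hz0]
    congr 1
    push_cast; ring
  -- Integrability of the `τ`-ratio integrands is inherited from the second identity, with which
  -- they agree on the circles up to constant matrix factors.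
  refine ⟨(second.int₁.mul_const _).congr hr₁0.le f₁,
    (second.int₂.const_mul _).congr hr₂0.le f₂, ?_⟩
  rw [← matCircle_congr hr₁0.le f₁, ← matCircle_congr hr₂0.le f₂, matCircle_mul_const second.int₁,
    matCircle_const_mul second.int₂, mul_assoc, quasitau, quasitau,
    Matrix.nonsing_inv_mul _ hHu, mul_one, Matrix.mul_nonsing_inv_cancel_left _ _ hHv]
  exact second.eq
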